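/- **Setting.** The language of second-order arithmetic is two-sorted first-order logic with equality on the number sort: number terms are built from number variables by $0,S,+,\cdot$, and atomic formulae are $s=t$, $s<t$ and $t\in X$ ($X$ a set variable). A formula is bounded if it has no set quantifiers and all its number quantifiers are bounded; a $\Sigma^0_1$ formula is a block of existential number quantifiers followed by a bounded formula (free set variables are allowed). $\mathsf{RCA}_0$ consists of Robinson arithmetic $\mathsf{Q}$ (with $x<y\leftrightarrow\exists z\,(x+Sz=y)$), the universal closures of the induction axioms for $\Sigma^0_1$ formulae, and the universal closures of the recursive comprehension axioms $$\forall x\,(\varphi(x)\leftrightarrow\neg\psi(x))\rightarrow\exists X\,\forall x\,(x\in X\leftrightarrow\varphi(x)),\qquad \varphi,\psi\in\Sigma^0_1,\ X \text{ not free in } \varphi,\psi .$$ $T\vdash\varphi$ means that $\varphi$ is a logical consequence of $T$, i.e. true in every two-sorted structure satisfying $T$ (the set quantifiers range over an arbitrary second domain). A nondeterministic Büchi automaton (NBA) is $\mathcal A=(A,Q,\delta,q_0,F)$ with a finite alphabet $A$, a finite set of states $Q$, $\delta\subseteq(Q\times A)\times Q$, $q_0\in Q$ and $F\subseteq Q$.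 Letters and states are coded injectively by natural numbers and named in formulae by numerals, and $X(s,t)$ abbreviates $(s+t)^2+s\in X$. For a finite set $S$, $X\in S^\omega$ is the formula $\forall x\,\exists y\in S\,X(x,y)\wedge\forall x,y,z\,(X(x,y)\wedge X(x,z)\rightarrow y=z)$, and $X\in\mathcal L(\mathcal A)$ is the formula $$X\in A^\omega\wedge\exists Y\in Q^\omega\,\bigl(Y(0,q_0)\wedge\forall x\,(Y(x),X(x),Y(Sx))\in\delta\wedge\forall x\,\exists x'>x\; Y(x')\in F\bigr).$$ **The complement automaton.** For a finite word $\sigma\in A^*$ let $\delta(\sigma):Q\times Q\to\{0,1,\infty\}$ be the matrix whose entry at $(q,q')$ is $\infty$ if some path of $\mathcal A$ from $q$ to $q'$ following $\sigma$ hits a state of $F$ after its starting point, is $1$ if there is a path from $q$ to $q'$ following $\sigma$ but none of this kind, and is $0$ otherwise. Let $\delta(A^*)=\{\delta(\sigma):\sigma\in A^*\}$, and compose matrices by $(\beta\gamma)(q,q')=\max_{p\in Q}\beta(q,p)\cdot\gamma(p,q')$, where $0\cdot\infty=\infty\cdot0=0$. A pair $(\beta,\gamma)$ is rejecting if $\beta\gamma=\beta$,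 $\gamma\gamma=\gamma$, and $\gamma(q,q)<\infty$ for every $q\in Q$ with $\beta(q_0,q)>0$. The NBA $\mathcal A^c$ has alphabet $A$, set of states $\{q_0\}\sqcup\delta(A^*)\sqcup\delta(A^*)^2\sqcup\delta(A^*)^3$, initial state $q_0$, set of accepting states $\delta(A^*)$, and the following transitions, for all $a\in A$ and $\beta,\gamma,\zeta\in\delta(A^*)$: - $(q_0,a,(\beta,\gamma,\delta(a)))$ if $(\beta,\gamma)$ is rejecting; - $((\beta,\gamma,\zeta),a,(\beta,\gamma,\zeta\delta(a)))$; - $((\beta,\gamma,\zeta),a,\gamma)$ if $\zeta\delta(a)=\beta$; - $(\gamma,a,(\gamma,\delta(a)))$; - $((\gamma,\zeta),a,(\gamma,\zeta\delta(a)))$; - $((\gamma,\zeta),a,\gamma)$ if $\zeta\delta(a)=\gamma$; - $(\gamma,a,\gamma)$ if $\delta(a)=\gamma$. **Proposition.** For every NBA $\mathcal A$ (and every choice of injective codings of the letters of $A$, of the states of $\mathcal A$ and of the states of $\mathcal A^c$ by natural numbers), $$\mathsf{RCA}_0\vdash\forall X\in A^\omega\,\bigl(X\in\mathcal L(\mathcal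 A^c)\leftrightarrow X\notin\mathcal L(\mathcal A)\bigr).$$ The quantification over automata is external to $\mathsf{RCA}_0$. -/

import Mathlib

universe u

/-! ### The two-sorted language of second-order arithmetic -/

namespace SOArith

/-- Number terms over `0, S, +, ·` with `n` number variables (de Bruijn indices). -/
inductive Tm (n : ℕ) : Type
  | var (i : Fin n) : Tm n
  | zero : Tm n
  | succ (t : Tm n) : Tm n
  | add (s t : Tm n) : Tm n
  | mul (s t : Tm n) : Tm n

/-- Formulae with `n` free number variables and `m` free set variables. Each quantifier binds
the variable with index `0` of its sort and shifts the others up by one. -/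
inductive Fm : ℕ → ℕ → Type
  | eq {n m : ℕ} (s t : Tm n) : Fm n m
  | lt {n m : ℕ} (s t : Tm n) : Fm n m
  | mem {n m : ℕ} (t : Tm n) (X : Fin m) : Fm n m
  | neg {n m : ℕ} (φ : Fm n m) : Fm n m
  | and {n m : ℕ} (φ ψ : Fm n m) : Fm n m
  | or {n m : ℕ} (φ ψ : Fm n m) : Fm n m
  | allN {n m : ℕ} (φ : Fm (n + 1) m) : Fm n m
  | exN {n m : ℕ} (φ : Fm (n + 1) m) : Fm n m
  | allS {n m : ℕ} (φ : Fm n (m + 1)) : Fm n m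
  | exS {n m : ℕ} (φ : Fm n (m + 1)) : Fm n m

/-- Simultaneous substitution of terms for number variables in a term. -/
def Tm.subst {n k : ℕ} (σ : Fin n → Tm k) : Tm n → Tm k
  | .var i => σ i
  | .zero => .zero
  | .succ t => .succ (t.subst σ)
  | .add s t => .add (s.subst σ) (t.subst σ)
  | .mul s t => .mul (s.subst σ) (t.subst σ)

/-- The term `t` in a context with one additional number variable (of index `0`). -/
def Tm.shift {n : ℕ} (t : Tm n) : Tm (n + 1) :=
  t.subst (fun i => .var i.succ)

/-- The numeral `S ⋯ S 0`. -/
def Tm.num {n : ℕ} : ℕ → Tm n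
  | 0 => .zero
  | k + 1 => .succ (Tm.num k)

namespace Fm

/-- Simultaneous (capture-avoiding) substitution of terms for number variables and renaming of
set variables. -/
def subst : {n m k l : ℕ} → (Fin n → Tm k) → (Fin m → Fin l) → Fm n m → Fm k l
  | _, _, _, _, σ, _, eq s t => eq (s.subst σ) (t.subst σ)
  | _, _, _, _, σ, _, lt s t => lt (s.subst σ) (t.subst σ)
  | _, _, _, _, σ, τ, mem t X => mem (t.subst σ) (τ X)
  | _, _, _, _, σ, τ, neg φ => neg (subst σ τ φ)
  | _, _, _, _, σ, τ, and φ ψ => and (subst σ τ φ) (subst σ τ ψ)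
  | _, _, _, _, σ, τ, or φ ψ => or (subst σ τ φ) (subst σ τ ψ)
  | _, _, _, _, σ, τ, allN φ => allN (subst (Fin.cons (.var 0) (fun i => (σ i).shift)) τ φ)
  | _, _, _, _, σ, τ, exN φ => exN (subst (Fin.cons (.var 0) (fun i => (σ i).shift)) τ φ)
  | _, _, _, _, σ, τ, allS φ => allS (subst σ (Fin.cons 0 (fun i => (τ i).succ)) φ)
  | _, _, _, _, σ, τ, exS φ => exS (subst σ (Fin.cons 0 (fun i => (τ i).succ)) φ)

/-- `φ ⊃ ψ`. -/
def imp {n m : ℕ} (φ ψ : Fm n m) : Fm n m := or (neg φ) ψ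

/-- `φ ≡ ψ`. -/
def iff {n m : ℕ} (φ ψ : Fm n m) : Fm n m := and (imp φ ψ) (imp ψ φ)

/-- Disjunction of a finite list of formulae; the empty disjunction is `¬ 0 = 0`. -/
def disj {n m : ℕ} : List (Fm n m) → Fm n m
  | [] => neg (eq .zero .zero)
  | φ :: l => or φ (disj l)

/-- Universal closure with respect to the number variables. -/
def closeN : {n m : ℕ} → Fm n m → Fm 0 m
  | 0, _, φ => φ
  | _ + 1, _, φ => closeN (allN φ)

/-- Universal closure with respect to the set variables. -/
def closeS : {m : ℕ} → Fm 0 m → Fm 0 0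
  | 0, φ => φ
  | _ + 1, φ => closeS (allS φ)

/-- Universal closure. -/
def close {n m : ℕ} (φ : Fm n m) : Fm 0 0 := closeS (closeN φ)

/-- Bounded formulae: no set quantifiers, and all number quantifiers are of the form
`∀ x < t` or `∃ x < t`, where the term `t` does not contain `x`. Free set variables may occur. -/
inductive Bounded : {n m : ℕ} → Fm n m → Prop
  | eq {n m : ℕ} (s t : Tm n) : Bounded (Fm.eq s t : Fm n m)
  | lt {n m : ℕ} (s t : Tm n) : Bounded (Fm.lt s t : Fm n m)
  | mem {n m : ℕ} (t : Tm n) (X : Fin m) : Bounded (Fm.mem t X)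
  | neg {n m : ℕ} {φ : Fm n m} : Bounded φ → Bounded (Fm.neg φ)
  | and {n m : ℕ} {φ ψ : Fm n m} : Bounded φ → Bounded ψ → Bounded (Fm.and φ ψ)
  | or {n m : ℕ} {φ ψ : Fm n m} : Bounded φ → Bounded ψ → Bounded (Fm.or φ ψ)
  | ballN {n m : ℕ} (t : Tm n) {φ : Fm (n + 1) m} : Bounded φ →
      Bounded (Fm.allN (Fm.imp (Fm.lt (.var 0) t.shift) φ))
  | bexN {n m : ℕ} (t : Tm n) {φ : Fm (n + 1) m} : Bounded φ →
      Bounded (Fm.exN (Fm.and (Fm.lt (.var 0) t.shift) φ))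

/-- `Σ⁰₁` formulae: a block of existential number quantifiers in front of a bounded formula. -/
inductive Sigma1 : {n m : ℕ} → Fm n m → Prop
  | bounded {n m : ℕ} {φ : Fm n m} : Bounded φ → Sigma1 φ
  | exN {n m : ℕ} {φ : Fm (n + 1) m} : Sigma1 φ → Sigma1 (Fm.exN φ)

end Fm

/-! ### Semantics: logical consequence -/

/-- A structure for the two-sorted language. Equality of numbers is interpreted as
true equality, the set quantifiers range over an arbitrary second domain. -/
structure Str : Type (u + 1) where
  Num : Type u
  Sets : Type u
  zero : Num
  succ : Num → Num
  add : Num → Num → Num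
  mul : Num → Num → Num
  lt : Num → Num → Prop
  mem : Num → Sets → Prop

/-- The value of a term. -/
def Tm.eval (M : Str.{u}) {n : ℕ} (ρ : Fin n → M.Num) : Tm n → M.Num
  | .var i => ρ i
  | .zero => M.zero
  | .succ t => M.succ (t.eval M ρ)
  | .add s t => M.add (s.eval M ρ) (t.eval M ρ)
  | .mul s t => M.mul (s.eval M ρ) (t.eval M ρ)

/-- Truth of a formula in a structure under an assignment. -/
def Fm.Realize (M : Str.{u}) :
    {n m : ℕ} → Fm n m → (Fin n → M.Num) → (Fin m → M.Sets) → Prop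
  | _, _, .eq s t, ρ, _ => s.eval M ρ = t.eval M ρ
  | _, _, .lt s t, ρ, _ => M.lt (s.eval M ρ) (t.eval M ρ)
  | _, _, .mem t X, ρ, η => M.mem (t.eval M ρ) (η X)
  | _, _, .neg φ, ρ, η => ¬ Fm.Realize M φ ρ η
  | _, _, .and φ ψ, ρ, η => Fm.Realize M φ ρ η ∧ Fm.Realize M ψ ρ η
  | _, _, .or φ ψ, ρ, η => Fm.Realize M φ ρ η ∨ Fm.Realize M ψ ρ η
  | _, _, .allN φ, ρ, η => ∀ a : M.Num, Fm.Realize M φ (Fin.cons a ρ) η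
  | _, _, .exN φ, ρ, η => ∃ a : M.Num, Fm.Realize M φ (Fin.cons a ρ) η
  | _, _, .allS φ, ρ, η => ∀ A : M.Sets, Fm.Realize M φ ρ (Fin.cons A η)
  | _, _, .exS φ, ρ, η => ∃ A : M.Sets, Fm.Realize M φ ρ (Fin.cons A η)

/-- Truth of a closed formula in a structure. -/
def Str.Sat (M : Str.{u}) (φ : Fm 0 0) : Prop :=
  φ.Realize M Fin.elim0 Fin.elim0

/-- `T ⊢ φ`: the closed formula `φ` is a logical consequence of the theory `T`, that is, `φ` is
true in every structure in which all members of `T` are true. -/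
def Proves (T : Set (Fm 0 0)) (φ : Fm 0 0) : Prop :=
  ∀ M : Str.{u}, (∀ ψ ∈ T, M.Sat ψ) → M.Sat φ

/-! ### The theory `RCA₀` -/

open Tm Fm in
/-- The axioms of Robinson arithmetic with inequality. -/
inductive RobinsonAx : Fm 0 0 → Prop
  /-- `∀ x. S x ≠ 0` -/
  | q1 : RobinsonAx (allN (neg (eq (succ (var 0)) zero)))
  /-- `∀ x y. (S x = S y ⊃ x = y)` -/
  | q2 : RobinsonAx (allN (allN
      (imp (eq (succ (var 1)) (succ (var 0))) (eq (var 1) (var 0)))))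
  /-- `∀ x. (x ≠ 0 ⊃ ∃ y. x = S y)` -/
  | q3 : RobinsonAx (allN
      (imp (neg (eq (var 0) zero)) (exN (eq (var 1) (succ (var 0))))))
  /-- `∀ x. x + 0 = x` -/
  | q4 : RobinsonAx (allN (eq (add (var 0) zero) (var 0)))
  /-- `∀ x y. x + S y = S (x + y)` -/
  | q5 : RobinsonAx (allN (allN
      (eq (add (var 1) (succ (var 0))) (succ (add (var 1) (var 0))))))
  /-- `∀ x. x · 0 = 0` -/
  | q6 : RobinsonAx (allN (eq (mul (var 0) zero) zero))
  /-- `∀ x y. x · S y = x · y + x` -/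
  | q7 : RobinsonAx (allN (allN
      (eq (mul (var 1) (succ (var 0))) (add (mul (var 1) (var 0)) (var 1)))))
  /-- `∀ x y. (x < y ≡ ∃ z. x + S z = y)` -/
  | q8 : RobinsonAx (allN (allN
      (iff (lt (var 1) (var 0)) (exN (eq (add (var 2) (succ (var 0))) (var 1))))))

/-- The induction axiom `(φ(0) ∧ ∀ x. (φ(x) ⊃ φ(S x))) ⊃ ∀ x. φ(x)`, where `x` is the number
variable `0`; the other free variables of `φ` are parameters. -/
def inductionAx {n m : ℕ} (φ : Fm (n + 1) m) : Fm n m :=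
  .imp
    (.and (φ.subst (Fin.cons .zero .var) id)
      (.allN (.imp φ (φ.subst (Fin.cons (.succ (.var 0)) (fun i => .var i.succ)) id))))
    (.allN φ)

/-- The comprehension axiom `∀ x. (φ(x) ≡ ¬ ψ(x)) ⊃ ∃ X. ∀ x. (x ∈ X ≡ φ(x))`, where `x` is the
number variable `0`; the other free variables of `φ` and `ψ` are parameters. -/
def comprehensionAx {n m : ℕ} (φ ψ : Fm (n + 1) m) : Fm n m :=
  .imp (.allN (.iff φ (.neg ψ)))
    (.exS (.allN (.iff (.mem (.var 0) 0) (φ.subst .var Fin.succ))))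

/-- `RCA₀`: Robinson arithmetic, induction for `Σ⁰₁` formulae and comprehension for `Δ⁰₁`
formulae, the schemata being closed universally. -/
inductive RCA0Ax : Fm 0 0 → Prop
  | robinson {φ : Fm 0 0} : RobinsonAx φ → RCA0Ax φ
  | induction {n m : ℕ} (φ : Fm (n + 1) m) : φ.Sigma1 → RCA0Ax (inductionAx φ).close
  | comprehension {n m : ℕ} (φ ψ : Fm (n + 1) m) : φ.Sigma1 → ψ.Sigma1 →
      RCA0Ax (comprehensionAx φ ψ).close

/-- The set of axioms of `RCA₀`. -/
def RCA0 : Set (Fm 0 0) := {φ | RCA0Ax φ}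

/-! ### Sets as binary predicates, and sequences over a finite set -/

/-- The pairing `(s + t)² + s`. -/
def Tm.pair {n : ℕ} (s t : Tm n) : Tm n := .add (.mul (.add s t) (.add s t)) s

/-- `X(s, t)`: the set `X` is read as a binary predicate. -/
def Fm.app {n m : ℕ} (X : Fin m) (s t : Tm n) : Fm n m := .mem (s.pair t) X

/-- For a subset `S` of a finite set whose elements are coded by natural numbers, the formula
`t ∈ S`, i.e. the disjunction of all `t = s` with `s ∈ S`. -/
noncomputable def Fm.inFin {α : Type*} [Finite α] (c : α → ℕ) (S : Set α) {n m : ℕ} (t : Tm n) :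
    Fm n m :=
  .disj ((Set.toFinite S).toFinset.toList.map (fun s => .eq t (.num (c s))))

/-- `X ∈ S^ω`, where `S` is a finite set coded by `c`:
`∀ x. ∃ y ∈ S. X(x, y)` and `∀ x y z. ((X(x, y) ∧ X(x, z)) ⊃ y = z)`. -/
noncomputable def Fm.isSeq {α : Type*} [Finite α] (c : α → ℕ) {n m : ℕ} (X : Fin m) : Fm n m :=
  .and
    (.allN (.exN (.and (.inFin c Set.univ (.var 0)) (.app X (.var 1) (.var 0)))))
    (.allN (.allN (.allN
      (.imp (.and (.app X (.var 2) (.var 1)) (.app X (.var 2) (.var 0)))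
        (.eq (.var 1) (.var 0))))))

end SOArith

/-! ### Büchi automata -/

/-- A nondeterministic Büchi automaton with alphabet `A` and set of states `Q`
(both will be finite). -/
structure NBA (A Q : Type*) where
  /-- the transition relation -/
  δ : Set ((Q × A) × Q)
  /-- the initial state -/
  q₀ : Q
  /-- the accepting states -/
  F : Set Q

namespace NBA

section Language

open SOArith

variable {A Q : Type*} [Finite A] [Finite Q]

/-- `(p, a, q) ∈ δ` for terms `p, a, q`. -/
noncomputable def inδ (𝒜 : NBA A Q) (cA : A → ℕ) (cQ : Q → ℕ) {n m : ℕ} (p a q : Tm n) :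
    Fm n m :=
  .disj ((Set.toFinite 𝒜.δ).toFinset.toList.map (fun e =>
    .and (.eq p (.num (cQ e.1.1))) (.and (.eq a (.num (cA e.1.2))) (.eq q (.num (cQ e.2))))))

/-- The formula `X ∈ L(𝒜)` in the free set variable `X`, where letters and states are coded by
`cA` and `cQ`: `X ∈ A^ω`, and there is `Y ∈ Q^ω` such that `Y(0, q₀)`,
`∀ x. (Y(x), X(x), Y(S x)) ∈ δ` and `∀ x. ∃ x' > x. Y(x') ∈ F`. -/
noncomputable def inLang (𝒜 : NBA A Q) (cA : A → ℕ) (cQ : Q → ℕ) {n m : ℕ} (X : Fin m) :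
    Fm n m :=
  .and (.isSeq cA X)
    (.exS (.and (.isSeq cQ 0)
      (.and (.app 0 .zero (.num (cQ 𝒜.q₀)))
        (.and
          -- the bound number variables are `x, p, a, q`, in this order
          (.allN (.exN (.exN (.exN
            (.and (.app 0 (.var 3) (.var 2))
              (.and (.app X.succ (.var 3) (.var 1))
                (.and (.app 0 (.succ (.var 3)) (.var 0))
                  (𝒜.inδ cA cQ (.var 2) (.var 1) (.var 0)))))))))
          -- the bound number variables are `x, x', y`, in this order
          (.allN (.exN (.and (.lt (.var 1) (.var 0))
            (.exN (.and (.app 0 (.var 1) (.var 0)) (.inFin cQ 𝒜.F (.var 0)))))))))))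

end Language

section Complement

variable {A Q : Type*}

/-- `x` is a path through `δ` from `q` to `q'` following the word `σ`. -/
def IsPath (𝒜 : NBA A Q) (σ : List A) (q q' : Q) (x : Fin (σ.length + 1) → Q) : Prop :=
  x 0 = q ∧ x (Fin.last _) = q' ∧
    ∀ i : Fin σ.length, ((x i.castSucc, σ.get i), x i.succ) ∈ 𝒜.δ

open Classical in
/-- The transition matrix `δ(σ) : Q × Q → {0, 1, ∞}` of a word `σ`: the entry at `(q, q')` is `∞`
if some path from `q` to `q'` following `σ` hits an accepting state after `q`, otherwise it is `1`
if there is a path from `q` to `q'` following `σ`, and `0` if there is none. -/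
noncomputable def transMatrix (𝒜 : NBA A Q) (σ : List A) (q q' : Q) : ℕ∞ :=
  if ∃ x, 𝒜.IsPath σ q q' x ∧ ∃ i, i ≠ 0 ∧ x i ∈ 𝒜.F then ⊤
  else if ∃ x, 𝒜.IsPath σ q q' x then 1
  else 0

/-- The composition `(βγ)(q, q') = max_p (β(q, p) · γ(p, q'))`, where `0 · ∞ = ∞ · 0 = 0`. -/
noncomputable def comp (β γ : Q → Q → ℕ∞) : Q → Q → ℕ∞ :=
  fun q q' => ⨆ p, β q p * γ p q'

/-- The set `δ(A*)` of all transition matrices of finite words. -/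
def Mat (𝒜 : NBA A Q) : Type _ := Set.range 𝒜.transMatrix

/-- The pair `(β, γ)` is rejecting. -/
def Rejecting (𝒜 : NBA A Q) (β γ : Q → Q → ℕ∞) : Prop :=
  comp β γ = β ∧ comp γ γ = γ ∧ ∀ q, 0 < β 𝒜.q₀ q → γ q q < ⊤

/-- The states `{q₀} ∪ δ(A*) ∪ δ(A*)² ∪ δ(A*)³` of the complement automaton. -/
inductive ComplState (𝒜 : NBA A Q)
  | init : ComplState 𝒜
  | one (γ : 𝒜.Mat) : ComplState 𝒜
  | two (γ ζ : 𝒜.Mat) : ComplState 𝒜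
  | three (β γ ζ : 𝒜.Mat) : ComplState 𝒜

/-- The transitions of the complement automaton. -/
inductive ComplStep (𝒜 : NBA A Q) : 𝒜.ComplState → A → 𝒜.ComplState → Prop
  | start (a : A) (β γ ζ : 𝒜.Mat) : 𝒜.Rejecting β.1 γ.1 → ζ.1 = 𝒜.transMatrix [a] →
      ComplStep 𝒜 .init a (.three β γ ζ)
  | threeStep (a : A) (β γ ζ ζ' : 𝒜.Mat) : ζ'.1 = comp ζ.1 (𝒜.transMatrix [a]) →
      ComplStep 𝒜 (.three β γ ζ) a (.three β γ ζ')
  | threeDone (a : A) (β γ ζ : 𝒜.Mat) : comp ζ.1 (𝒜.transMatrix [a]) = β.1 →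
      ComplStep 𝒜 (.three β γ ζ) a (.one γ)
  | oneStep (a : A) (γ ζ : 𝒜.Mat) : ζ.1 = 𝒜.transMatrix [a] →
      ComplStep 𝒜 (.one γ) a (.two γ ζ)
  | twoStep (a : A) (γ ζ ζ' : 𝒜.Mat) : ζ'.1 = comp ζ.1 (𝒜.transMatrix [a]) →
      ComplStep 𝒜 (.two γ ζ) a (.two γ ζ')
  | twoDone (a : A) (γ ζ : 𝒜.Mat) : comp ζ.1 (𝒜.transMatrix [a]) = γ.1 →
      ComplStep 𝒜 (.two γ ζ) a (.one γ)
  | oneDone (a : A) (γ : 𝒜.Mat) : 𝒜.transMatrix [a] = γ.1 →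
      ComplStep 𝒜 (.one γ) a (.one γ)

/-- The complement automaton `𝒜ᶜ`, which guesses a rejecting factorisation of the input. -/
def compl (𝒜 : NBA A Q) : NBA A 𝒜.ComplState where
  δ := {e | 𝒜.ComplStep e.1.1 e.1.2 e.2}
  q₀ := .init
  F := Set.range .one

instance (𝒜 : NBA A Q) [Finite Q] : Finite 𝒜.Mat := by
  have h : (Set.pi Set.univ fun _ : Q => Set.pi Set.univ fun _ : Q =>
      ({0, 1, ⊤} : Set ℕ∞)).Finite :=
    Set.Finite.pi fun _ => Set.Finite.pi fun _ => Set.toFinite _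
  refine Set.Finite.to_subtype (h.subset ?_)
  rintro _ ⟨σ, rfl⟩ q _ q' _
  unfold transMatrix
  split_ifs <;> simp

instance (𝒜 : NBA A Q) [Finite Q] : Finite 𝒜.ComplState := by
  let f : Unit ⊕ 𝒜.Mat ⊕ (𝒜.Mat × 𝒜.Mat) ⊕ (𝒜.Mat × 𝒜.Mat × 𝒜.Mat) → 𝒜.ComplState
    | .inl _ => .init
    | .inr (.inl γ) => .one γ
    | .inr (.inr (.inl p)) => .two p.1 p.2
    | .inr (.inr (.inr p)) => .three p.1 p.2.1 p.2.2
  refine Finite.of_surjective f ?_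
  rintro (_ | γ | ⟨γ, ζ⟩ | ⟨β, γ, ζ⟩)
  · exact ⟨.inl (), rfl⟩
  · exact ⟨.inr (.inl γ), rfl⟩
  · exact ⟨.inr (.inr (.inl (γ, ζ))), rfl⟩
  · exact ⟨.inr (.inr (.inr (β, γ, ζ))), rfl⟩

end Complement

open SOArith in
/-- The closed formula `∀ X ∈ A^ω. (X ∈ L(𝒜ᶜ) ≡ X ∉ L(𝒜))`, where the letters, the states of `𝒜`
and the states of `𝒜ᶜ` are coded by `cA`, `cQ` and `cQc`. -/
noncomputable def complCorrect {A Q : Type*} [Finite A] [Finite Q] (𝒜 : NBA A Q)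
    (cA : A → ℕ) (cQ : Q → ℕ) (cQc : 𝒜.ComplState → ℕ) : Fm 0 0 :=
  .allS (.imp (.isSeq cA 0)
    (.iff (𝒜.compl.inLang cA cQc 0) (.neg (𝒜.inLang cA cQ 0))))

end NBA

/-!
In a model of `RCA₀`, `Σ⁰₁` induction and recursive comprehension provide the functions into a
finite set that are defined by primitive recursion, by means of Gödel's coding of finite sequences.
Let `c x y` be the transition matrix of the part of the input word between the positions `x` and
`y`. Ramsey's theorem for `c` is not provable in `RCA₀`, but there is an unbounded set `H` that is
homogeneous in a weak sense, where `c x y` has the required value `γ` only for `y` large with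
respect to `x`.

If `c x y` is `γ` for all `x < y` in an unbounded set `P`, and `c 0 x` is `β` for `x` in `P`, then
`𝒜` accepts the word if and only if `β(q₀, q) > 0` and `γ(q, q) = ∞` for some `q`; in one direction,
the accepting run chooses its transitions by looking ahead to the next position in `P`. An accepting
run of `𝒜ᶜ` is such a factorisation `β γ γ …` for a rejecting pair, and thus `𝒜` does not accept.
Conversely, the run of `𝒜ᶜ` that ends each factor at the first possible position in `H` turns the
weakly homogeneous set into such a factorisation, and its pair `(β, γ)` is rejecting unless `𝒜`
accepts.
-/

namespace SOArith

/-! ### Substitution -/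

section Substitution

variable (M : Str.{u}) {n m k l : ℕ}

theorem Tm.eval_subst (σ : Fin n → Tm k) (ρ : Fin k → M.Num) (t : Tm n) :
    (t.subst σ).eval M ρ = t.eval M fun i => (σ i).eval M ρ := by
  induction t with
  | var i => rfl
  | zero => rfl
  | succ t ih => simp only [Tm.subst, Tm.eval, ih]
  | add s t ihs iht => simp only [Tm.subst, Tm.eval, ihs, iht]
  | mul s t ihs iht => simp only [Tm.subst, Tm.eval, ihs, iht]

theorem Tm.eval_shift (t : Tm n) (a : M.Num) (ρ : Fin n → M.Num) :
    t.shift.eval M (Fin.cons a ρ) = t.eval M ρ := by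
  simp only [Tm.shift, Tm.eval_subst, Tm.eval, Fin.cons_succ]

/-- The substitution `σ` under a number quantifier. -/
def Tm.liftSubst (σ : Fin n → Tm k) : Fin (n + 1) → Tm (k + 1) :=
  Fin.cons (.var 0) fun i => (σ i).shift

theorem Tm.eval_liftSubst (σ : Fin n → Tm k) (a : M.Num) (ρ : Fin k → M.Num) :
    (fun i => (liftSubst σ i).eval M (Fin.cons a ρ)) =
      (Fin.cons a fun i => (σ i).eval M ρ : Fin (n + 1) → M.Num) := by
  funext i
  cases i using Fin.cases with
  | zero => rfl
  | succ i => simp only [liftSubst, Fin.cons_succ, Tm.eval_shift]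

theorem Tm.shift_subst_liftSubst (σ : Fin n → Tm k) (t : Tm n) :
    t.shift.subst (liftSubst σ) = (t.subst σ).shift := by
  induction t with
  | var i => rfl
  | zero => rfl
  | succ t ih => exact congrArg Tm.succ ih
  | add s t ihs iht => exact congrArg₂ Tm.add ihs iht
  | mul s t ihs iht => exact congrArg₂ Tm.mul ihs iht

theorem Fm.realize_subst (φ : Fm n m) (σ : Fin n → Tm k) (τ : Fin m → Fin l)
    (ρ : Fin k → M.Num) (η : Fin l → M.Sets) :
    (φ.subst σ τ).Realize M ρ η ↔ φ.Realize M (fun i => (σ i).eval M ρ) (η ∘ τ) := by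
  have lift_sets {m l : ℕ} (τ : Fin m → Fin l) (η : Fin l → M.Sets) (A : M.Sets) :
      (Fin.cons A η : Fin (l + 1) → M.Sets) ∘ (Fin.cons 0 fun i => (τ i).succ) =
        (Fin.cons A (η ∘ τ) : Fin (m + 1) → M.Sets) := by
    funext i
    cases i using Fin.cases <;> rfl
  induction φ generalizing k l with
  | eq s t => simp only [Fm.subst, Fm.Realize, Tm.eval_subst]
  | lt s t => simp only [Fm.subst, Fm.Realize, Tm.eval_subst]
  | mem t X => simp only [Fm.subst, Fm.Realize, Tm.eval_subst, Function.comp_apply]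
  | neg φ ih => simp only [Fm.subst, Fm.Realize, ih]
  | and φ ψ ih₁ ih₂ => simp only [Fm.subst, Fm.Realize, ih₁, ih₂]
  | or φ ψ ih₁ ih₂ => simp only [Fm.subst, Fm.Realize, ih₁, ih₂]
  | allN φ ih =>
    exact forall_congr' fun a => (ih _ _ _ _).trans (by rw [← Tm.eval_liftSubst]; rfl)
  | exN φ ih =>
    exact exists_congr fun a => (ih _ _ _ _).trans (by rw [← Tm.eval_liftSubst]; rfl)
  | allS φ ih => simp only [Fm.subst, Fm.Realize, ih, lift_sets]
  | exS φ ih => simp only [Fm.subst, Fm.Realize, ih, lift_sets]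

theorem Fm.Bounded.subst {φ : Fm n m} (h : φ.Bounded) (σ : Fin n → Tm k) (τ : Fin m → Fin l) :
    (φ.subst σ τ).Bounded := by
  induction h generalizing k l with
  | eq s t => exact .eq _ _
  | lt s t => exact .lt _ _
  | mem t X => exact .mem _ _
  | neg _ ih => exact .neg (ih _ _)
  | and _ _ ih₁ ih₂ => exact .and (ih₁ _ _) (ih₂ _ _)
  | or _ _ ih₁ ih₂ => exact .or (ih₁ _ _) (ih₂ _ _)
  | ballN t _ ih =>
    have := ih (Tm.liftSubst σ) τ
    have := Fm.Bounded.ballN (t.subst σ) this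
    rwa [← Tm.shift_subst_liftSubst] at this
  | bexN t _ ih =>
    have := ih (Tm.liftSubst σ) τ
    have := Fm.Bounded.bexN (t.subst σ) this
    rwa [← Tm.shift_subst_liftSubst] at this

theorem Fm.Sigma1.subst {φ : Fm n m} (h : φ.Sigma1) (σ : Fin n → Tm k) (τ : Fin m → Fin l) :
    (φ.subst σ τ).Sigma1 := by
  induction h generalizing k l with
  | bounded h => exact .bounded (h.subst σ τ)
  | exN _ ih => exact .exN (ih _ _)

/-- The formula `φ` in a context with one additional number variable (of index `0`). -/
def Fm.shift (φ : Fm n m) : Fm (n + 1) m :=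
  φ.subst (fun i => .var i.succ) id

theorem Fm.realize_shift (φ : Fm n m) (a : M.Num) (ρ : Fin n → M.Num) (η : Fin m → M.Sets) :
    φ.shift.Realize M (Fin.cons a ρ) η ↔ φ.Realize M ρ η := by
  simp only [shift, realize_subst, Tm.eval, Fin.cons_succ, Function.comp_id]

theorem Fm.realize_of_realize_closeN {φ : Fm n m} {η : Fin m → M.Sets}
    (h : φ.closeN.Realize M Fin.elim0 η) (ρ : Fin n → M.Num) : φ.Realize M ρ η := by
  induction n with
  | zero => rwa [Subsingleton.elim ρ Fin.elim0]
  | succ n ih =>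
    have : (Fm.allN φ).Realize M (Fin.tail ρ) η := ih h _
    exact Fin.cons_self_tail ρ ▸ this (ρ 0)

theorem Fm.realize_of_sat_closeS {φ : Fm 0 m} (h : M.Sat φ.closeS) (η : Fin m → M.Sets) :
    φ.Realize M Fin.elim0 η := by
  induction m with
  | zero => rwa [Subsingleton.elim η Fin.elim0]
  | succ m ih =>
    have : (Fm.allS φ).Realize M Fin.elim0 (Fin.tail η) := ih h _
    exact Fin.cons_self_tail η ▸ this (η 0)

theorem Fm.realize_of_sat_close {φ : Fm n m} (h : M.Sat φ.close) (ρ : Fin n → M.Num)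
    (η : Fin m → M.Sets) : φ.Realize M ρ η :=
  realize_of_realize_closeN M (realize_of_sat_closeS M h η) ρ

/-- Prenexing: the connective `op`, with truth function `F`, may be any one that commutes with
existential quantifiers in both arguments. -/
theorem Fm.Sigma1.exists_connective {op : ∀ {n m : ℕ}, Fm n m → Fm n m → Fm n m}
    {F : Prop → Prop → Prop}
    (realize_op : ∀ {n m : ℕ} (φ ψ : Fm n m) (ρ : Fin n → M.Num) (η : Fin m → M.Sets),
      (op φ ψ).Realize M ρ η ↔ F (φ.Realize M ρ η) (ψ.Realize M ρ η))
    (bounded_op : ∀ {n m : ℕ} {φ ψ : Fm n m}, φ.Bounded → ψ.Bounded → (op φ ψ).Bounded)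
    (exists_left : ∀ (p : M.Num → Prop) (q : Prop), F (∃ x, p x) q ↔ ∃ x, F (p x) q)
    (exists_right : ∀ (p : Prop) (q : M.Num → Prop), F p (∃ x, q x) ↔ ∃ x, F p (q x))
    {φ ψ : Fm n m} (hφ : φ.Sigma1) (hψ : ψ.Sigma1) :
    ∃ χ : Fm n m, χ.Sigma1 ∧
      ∀ ρ η, χ.Realize M ρ η ↔ F (φ.Realize M ρ η) (ψ.Realize M ρ η) := by
  induction hφ with
  | bounded hφ =>
    induction hψ with
    | bounded hψ => exact ⟨_, .bounded (bounded_op hφ hψ), realize_op _ _⟩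
    | exN _ ih =>
      obtain ⟨χ, hχ, h⟩ := ih (hφ.subst (fun i => .var i.succ) id)
      refine ⟨_, .exN hχ, fun ρ η => ?_⟩
      simp only [Fm.Realize, h, exists_right]
      exact exists_congr fun a => by rw [← realize_shift M _ a ρ η]; rfl
  | exN _ ih =>
    obtain ⟨χ, hχ, h⟩ := ih (hψ.subst (fun i => .var i.succ) id)
    refine ⟨_, .exN hχ, fun ρ η => ?_⟩
    simp only [Fm.Realize, h, exists_left]
    exact exists_congr fun a => by rw [← realize_shift M _ a ρ η]; rfl

end Substitution

/-! ### Definability with parameters -/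

namespace Str

variable (M : Str.{u})

instance : Zero M.Num := ⟨M.zero⟩

instance : One M.Num := ⟨M.succ M.zero⟩

instance : Add M.Num := ⟨M.add⟩

instance : Mul M.Num := ⟨M.mul⟩

instance : LT M.Num := ⟨M.lt⟩

end Str

section Definability

variable {M : Str.{u}} {n : ℕ}

/-- The assignment that evaluates each of `l` variables either to one of `n` arguments or to a
fixed parameter. -/
def assign {l : ℕ} (e : Fin l → Fin n ⊕ M.Num) (v : Fin n → M.Num) : Fin l → M.Num :=
  fun i => Sum.elim v id (e i)

/-- The functions given by a term with parameters. -/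
class TermFun (f : (Fin n → M.Num) → M.Num) : Prop where
  exists_term : ∃ (l : ℕ) (t : Tm l) (e : Fin l → Fin n ⊕ M.Num),
    ∀ v, f v = t.eval M (assign e v)

/-- The relations given by a formula of the class `C` with number and set parameters. -/
class Definable (C : ∀ {n m : ℕ}, Fm n m → Prop) (P : (Fin n → M.Num) → Prop) : Prop where
  exists_formula : ∃ (l m : ℕ) (φ : Fm l m) (e : Fin l → Fin n ⊕ M.Num) (η : Fin m → M.Sets),
    C φ ∧ ∀ v, P v ↔ φ.Realize M (assign e v) η

/-- The relations given by a bounded formula with parameters. -/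
abbrev BoundedRel (P : (Fin n → M.Num) → Prop) : Prop := Definable Fm.Bounded P

/-- The relations given by a `Σ⁰₁` formula with parameters. -/
abbrev SigmaRel (P : (Fin n → M.Num) → Prop) : Prop := Definable Fm.Sigma1 P

theorem assign_append_castAdd {l l' : ℕ} (e : Fin l → Fin n ⊕ M.Num)
    (e' : Fin l' → Fin n ⊕ M.Num) (v : Fin n → M.Num) (i : Fin l) :
    assign (Fin.append e e') v (i.castAdd l') = assign e v i := by
  simp only [assign, Fin.append_left]

theorem assign_append_natAdd {l l' : ℕ} (e : Fin l → Fin n ⊕ M.Num)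
    (e' : Fin l' → Fin n ⊕ M.Num) (v : Fin n → M.Num) (i : Fin l') :
    assign (Fin.append e e') v (i.natAdd l) = assign e' v i := by
  simp only [assign, Fin.append_right]

theorem assign_map_succ {l : ℕ} (e : Fin l → Fin n ⊕ M.Num) (w : Fin (n + 1) → M.Num) :
    assign (fun i => (e i).map Fin.succ id) w = assign e fun i => w i.succ := by
  funext i
  rcases h : e i with j | c <;> simp only [assign, h, Sum.map_inl, Sum.map_inr, Sum.elim_inl,
    Sum.elim_inr, id]

theorem TermFun.exists_common {f g : (Fin n → M.Num) → M.Num} (hf : TermFun f) (hg : TermFun g) :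
    ∃ (l : ℕ) (s t : Tm l) (e : Fin l → Fin n ⊕ M.Num),
      ∀ v, f v = s.eval M (assign e v) ∧ g v = t.eval M (assign e v) := by
  obtain ⟨l, s, e, hs⟩ := hf.exists_term
  obtain ⟨l', t, e', ht⟩ := hg.exists_term
  refine ⟨l + l', s.subst fun i => .var (i.castAdd _), t.subst fun i => .var (i.natAdd _),
    Fin.append e e', fun v => ?_⟩
  simp only [Tm.eval_subst, Tm.eval, assign_append_castAdd, assign_append_natAdd, hs, ht, and_self]

theorem Definable.exists_common {C : ∀ {n m : ℕ}, Fm n m → Prop}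
    (hC : ∀ {n m k l : ℕ} {φ : Fm n m}, C φ → ∀ (σ : Fin n → Tm k) (τ : Fin m → Fin l),
      C (φ.subst σ τ))
    {P R : (Fin n → M.Num) → Prop} (hP : Definable C P) (hR : Definable C R) :
    ∃ (l m : ℕ) (φ ψ : Fm l m) (e : Fin l → Fin n ⊕ M.Num) (η : Fin m → M.Sets), C φ ∧ C ψ ∧
      ∀ v, (P v ↔ φ.Realize M (assign e v) η) ∧ (R v ↔ ψ.Realize M (assign e v) η) := by
  obtain ⟨l, m, φ, e, η, hφ, h⟩ := hP.exists_formula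
  obtain ⟨l', m', ψ, e', η', hψ, h'⟩ := hR.exists_formula
  refine ⟨l + l', m + m', φ.subst (fun i => .var (i.castAdd _)) (Fin.castAdd _),
    ψ.subst (fun i => .var (i.natAdd _)) (Fin.natAdd _), Fin.append e e', Fin.append η η',
    hC hφ _ _, hC hψ _ _, fun v => ?_⟩
  simp only [Fm.realize_subst, Tm.eval, assign_append_castAdd, assign_append_natAdd, h, h',
    Function.comp_def, Fin.append_left, Fin.append_right, and_self]

/-- Those variables of `φ` that `e` evaluates to the first argument are replaced by the new
variable `0`. -/
def Fm.bindHead {l m : ℕ} (e : Fin l → Fin (n + 1) ⊕ M.Num) (φ : Fm l m) : Fm (l + 1) m :=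
  φ.subst (fun i => Sum.elim (Fin.cons (.var 0) fun _ => .var i.succ) (fun _ => .var i.succ) (e i))
    id

/-- The evaluation of the variables `≥ 1` of `Fm.bindHead e φ`; those replaced by the variable `0`
get a junk value. -/
def tailParams {l : ℕ} (e : Fin l → Fin (n + 1) ⊕ M.Num) (i : Fin l) : Fin n ⊕ M.Num :=
  Sum.elim (Fin.cons (.inr 0) .inl) .inr (e i)

theorem Fm.realize_bindHead {l m : ℕ} (e : Fin l → Fin (n + 1) ⊕ M.Num) (φ : Fm l m) (x : M.Num)
    (v : Fin n → M.Num) (η : Fin m → M.Sets) :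
    (φ.bindHead e).Realize M (Fin.cons x (assign (tailParams e) v)) η ↔
      φ.Realize M (assign e (Fin.cons x v)) η := by
  rw [bindHead, realize_subst, Function.comp_id]
  congr! 1
  funext i
  rcases h : e i with j | c
  · cases j using Fin.cases <;> simp [assign, tailParams, Tm.eval, h]
  · simp [assign, tailParams, Tm.eval, h]

instance TermFun.var (i : Fin n) : TermFun (M := M) fun v => v i :=
  ⟨1, .var 0, fun _ => .inl i, fun _ => rfl⟩

instance TermFun.const (c : M.Num) : TermFun (n := n) fun _ => c :=
  ⟨1, .var 0, fun _ => .inr c, fun _ => rfl⟩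

instance TermFun.tail (f : (Fin n → M.Num) → M.Num) [hf : TermFun f] :
    TermFun fun w : Fin (n + 1) → M.Num => f fun i => w i.succ := by
  obtain ⟨l, t, e, h⟩ := hf.exists_term
  exact ⟨l, t, fun i => (e i).map Fin.succ id, fun v => by simp only [h, assign_map_succ]⟩

instance TermFun.add (f g : (Fin n → M.Num) → M.Num) [hf : TermFun f] [hg : TermFun g] :
    TermFun fun v => f v + g v := by
  obtain ⟨l, s, t, e, h⟩ := hf.exists_common hg
  exact ⟨l, .add s t, e, fun v => congrArg₂ M.add (h v).1 (h v).2⟩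

instance TermFun.mul (f g : (Fin n → M.Num) → M.Num) [hf : TermFun f] [hg : TermFun g] :
    TermFun fun v => f v * g v := by
  obtain ⟨l, s, t, e, h⟩ := hf.exists_common hg
  exact ⟨l, .mul s t, e, fun v => congrArg₂ M.mul (h v).1 (h v).2⟩

instance BoundedRel.eq (f g : (Fin n → M.Num) → M.Num) [hf : TermFun f] [hg : TermFun g] :
    BoundedRel fun v => f v = g v := by
  obtain ⟨l, s, t, e, h⟩ := hf.exists_common hg
  exact ⟨l, 0, .eq s t, e, Fin.elim0, .eq _ _, fun v => by simp only [Fm.Realize, h]⟩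

instance BoundedRel.lt (f g : (Fin n → M.Num) → M.Num) [hf : TermFun f] [hg : TermFun g] :
    BoundedRel fun v => f v < g v := by
  obtain ⟨l, s, t, e, h⟩ := hf.exists_common hg
  exact ⟨l, 0, .lt s t, e, Fin.elim0, .lt _ _, fun v => by simp only [Fm.Realize, h]; rfl⟩

instance BoundedRel.mem (f : (Fin n → M.Num) → M.Num) (A : M.Sets) [hf : TermFun f] :
    BoundedRel fun v => M.mem (f v) A := by
  obtain ⟨l, t, e, h⟩ := hf.exists_term
  exact ⟨l, 1, .mem t 0, e, fun _ => A, .mem _ _, fun v => by simp only [Fm.Realize, h]⟩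

instance BoundedRel.not (P : (Fin n → M.Num) → Prop) [hP : BoundedRel P] :
    BoundedRel fun v => ¬ P v := by
  obtain ⟨l, m, φ, e, η, hφ, h⟩ := hP.exists_formula
  exact ⟨l, m, .neg φ, e, η, .neg hφ, fun v => by simp only [Fm.Realize, h]⟩

instance BoundedRel.and (P R : (Fin n → M.Num) → Prop) [hP : BoundedRel P] [hR : BoundedRel R] :
    BoundedRel fun v => P v ∧ R v := by
  obtain ⟨l, m, φ, ψ, e, η, hφ, hψ, h⟩ := hP.exists_common Fm.Bounded.subst hR
  exact ⟨l, m, .and φ ψ, e, η, .and hφ hψ, fun v => by simp only [Fm.Realize, h]⟩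

instance BoundedRel.or (P R : (Fin n → M.Num) → Prop) [hP : BoundedRel P] [hR : BoundedRel R] :
    BoundedRel fun v => P v ∨ R v := by
  obtain ⟨l, m, φ, ψ, e, η, hφ, hψ, h⟩ := hP.exists_common Fm.Bounded.subst hR
  exact ⟨l, m, .or φ ψ, e, η, .or hφ hψ, fun v => by simp only [Fm.Realize, h]⟩

instance BoundedRel.imp (P R : (Fin n → M.Num) → Prop) [hP : BoundedRel P] [hR : BoundedRel R] :
    BoundedRel fun v => P v → R v := by
  simpa only [imp_iff_not_or] using BoundedRel.or (fun v => ¬ P v) R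

instance BoundedRel.iff (P R : (Fin n → M.Num) → Prop) [hP : BoundedRel P] [hR : BoundedRel R] :
    BoundedRel fun v => P v ↔ R v := by
  simp only [iff_def]
  infer_instance

instance BoundedRel.const (p : Prop) : BoundedRel (M := M) (n := n) fun _ => p := by
  by_cases hp : p
  · simpa only [hp] using BoundedRel.eq (M := M) (n := n) (fun _ => 0) fun _ => 0
  · simpa only [hp, not_true] using
      BoundedRel.not (M := M) (n := n) fun _ => (0 : M.Num) = 0

instance BoundedRel.exists_lt (t : (Fin n → M.Num) → M.Num) (P : M.Num → (Fin n → M.Num) → Prop)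
    [ht : TermFun t] [hP : BoundedRel (n := n + 1) fun w => P (w 0) fun i => w i.succ] :
    BoundedRel fun v => ∃ x, x < t v ∧ P x v := by
  obtain ⟨l, m, φ, e, η, hφ, h⟩ := hP.exists_formula
  obtain ⟨l', s, e', h'⟩ := ht.exists_term
  refine ⟨l + l', m, .exN (.and (.lt (.var 0) (Tm.shift (s.subst fun i => .var (i.natAdd _))))
    ((φ.bindHead e).subst (Tm.liftSubst fun i => .var (i.castAdd l')) id)),
    Fin.append (tailParams e) e', η, .bexN _ ((hφ.subst _ _).subst _ _), fun v => ?_⟩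
  simp only [Fm.Realize, Tm.eval_shift, Tm.eval_subst, Tm.eval, Fin.cons_zero,
    assign_append_natAdd, h', Fm.realize_subst, Tm.eval_liftSubst, assign_append_castAdd,
    Function.comp_id]
  exact exists_congr fun x => and_congr_right fun _ =>
    (h (Fin.cons x v)).trans (φ.realize_bindHead e x v η).symm

instance BoundedRel.forall_lt (t : (Fin n → M.Num) → M.Num) (P : M.Num → (Fin n → M.Num) → Prop)
    [ht : TermFun t] [hP : BoundedRel (n := n + 1) fun w => P (w 0) fun i => w i.succ] :
    BoundedRel fun v => ∀ x, x < t v → P x v := by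
  have := BoundedRel.not fun w : Fin (n + 1) → M.Num => P (w 0) fun i => w i.succ
  simpa only [not_exists, not_and, not_not] using
    BoundedRel.not fun v => ∃ x, x < t v ∧ ¬ P x v

theorem Definable.exists_finite {C : ∀ {n m : ℕ}, Fm n m → Prop}
    (h_false : Definable (M := M) (n := n) C fun _ => False)
    (h_or : ∀ P R : (Fin n → M.Num) → Prop, Definable C P → Definable C R →
      Definable C fun v => P v ∨ R v)
    {S : Type*} [Finite S] {P : S → (Fin n → M.Num) → Prop} (hP : ∀ s, Definable C (P s)) :
    Definable C fun v => ∃ s, P s v := by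
  cases nonempty_fintype S
  have : Definable C (Finset.univ.sup P) :=
    Finset.sup_induction h_false (fun P hP R hR => h_or P R hP hR) fun s _ => hP s
  convert this using 2
  simp only [Finset.sup_univ_eq_iSup, iSup_apply, iSup_Prop_eq]

instance BoundedRel.exists_finite {S : Type*} [Finite S] (P : S → (Fin n → M.Num) → Prop)
    [hP : ∀ s, BoundedRel (P s)] : BoundedRel fun v => ∃ s, P s v :=
  Definable.exists_finite inferInstance (fun _ _ _ _ => inferInstance) hP

instance BoundedRel.forall_finite {S : Type*} [Finite S] (P : S → (Fin n → M.Num) → Prop)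
    [hP : ∀ s, BoundedRel (P s)] : BoundedRel fun v => ∀ s, P s v := by
  simpa only [not_exists, not_not] using BoundedRel.not fun v => ∃ s, ¬ P s v

instance SigmaRel.of_boundedRel (P : (Fin n → M.Num) → Prop) [hP : BoundedRel P] : SigmaRel P := by
  obtain ⟨l, m, φ, e, η, hφ, h⟩ := hP.exists_formula
  exact ⟨l, m, φ, e, η, .bounded hφ, h⟩

instance SigmaRel.exists (P : M.Num → (Fin n → M.Num) → Prop)
    [hP : SigmaRel (n := n + 1) fun w => P (w 0) fun i => w i.succ] :
    SigmaRel fun v => ∃ x, P x v := by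
  obtain ⟨l, m, φ, e, η, hφ, h⟩ := hP.exists_formula
  exact ⟨l, m, .exN (φ.bindHead e), tailParams e, η, .exN (hφ.subst _ _), fun v =>
    exists_congr fun x => (h (Fin.cons x v)).trans (φ.realize_bindHead e x v η).symm⟩

instance SigmaRel.and (P R : (Fin n → M.Num) → Prop) [hP : SigmaRel P] [hR : SigmaRel R] :
    SigmaRel fun v => P v ∧ R v := by
  obtain ⟨l, m, φ, ψ, e, η, hφ, hψ, h⟩ := hP.exists_common Fm.Sigma1.subst hR
  obtain ⟨χ, hχ, h'⟩ := Fm.Sigma1.exists_connective M (op := .and) (fun _ _ _ _ => Iff.rfl) .and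
    (fun _ _ => exists_and_right.symm) (fun _ _ => exists_and_left.symm) hφ hψ
  exact ⟨l, m, χ, e, η, hχ, fun v => by simp only [h, h']⟩

instance SigmaRel.or (P R : (Fin n → M.Num) → Prop) [hP : SigmaRel P] [hR : SigmaRel R] :
    SigmaRel fun v => P v ∨ R v := by
  have : Nonempty M.Num := ⟨0⟩
  obtain ⟨l, m, φ, ψ, e, η, hφ, hψ, h⟩ := hP.exists_common Fm.Sigma1.subst hR
  obtain ⟨χ, hχ, h'⟩ := Fm.Sigma1.exists_connective M (op := .or) (fun _ _ _ _ => Iff.rfl) .or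
    (by simp only [exists_or, exists_const, implies_true])
    (by simp only [exists_or, exists_const, implies_true]) hφ hψ
  exact ⟨l, m, χ, e, η, hχ, fun v => by simp only [h, h']⟩

instance SigmaRel.exists_finite {S : Type*} [Finite S] (P : S → (Fin n → M.Num) → Prop)
    [hP : ∀ s, SigmaRel (P s)] : SigmaRel fun v => ∃ s, P s v :=
  Definable.exists_finite inferInstance (fun _ _ _ _ => inferInstance) hP

end Definability

/-! ### Models of `RCA₀` -/

theorem Fm.realize_inductionAx (M : Str.{u}) {n m : ℕ} (φ : Fm (n + 1) m) (ρ : Fin n → M.Num)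
    (η : Fin m → M.Sets) :
    (inductionAx φ).Realize M ρ η ↔
      (φ.Realize M (Fin.cons 0 ρ) η ∧
        ∀ a, φ.Realize M (Fin.cons a ρ) η → φ.Realize M (Fin.cons (M.succ a) ρ) η) →
      ∀ a, φ.Realize M (Fin.cons a ρ) η := by
  have eval_zero : (fun i => (Fin.cons .zero .var : Fin (n + 1) → Tm n) i |>.eval M ρ) =
      (Fin.cons 0 ρ : Fin (n + 1) → M.Num) := by
    funext i
    cases i using Fin.cases <;> rfl
  have eval_succ (a : M.Num) : (fun i => (Fin.cons (.succ (.var 0)) fun i => .var i.succ :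
      Fin (n + 1) → Tm (n + 1)) i |>.eval M (Fin.cons a ρ)) =
      (Fin.cons (M.succ a) ρ : Fin (n + 1) → M.Num) := by
    funext i
    cases i using Fin.cases <;> rfl
  simp only [inductionAx, Fm.imp, Fm.Realize, realize_subst, ← imp_iff_not_or, eval_zero,
    eval_succ, Function.comp_id]

/-- `M` is a model of `RCA₀`. -/
class IsModel (M : Str.{u}) : Prop where
  sat : ∀ ψ ∈ RCA0, M.Sat ψ

section Axioms

variable {M : Str.{u}} [hM : IsModel M]

theorem Str.Num.succ_induction {P : M.Num → Prop} [hP : SigmaRel fun v : Fin 1 → M.Num => P (v 0)]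
    (zero : P 0) (succ : ∀ x, P x → P (M.succ x)) (x : M.Num) : P x := by
  obtain ⟨l, m, φ, e, η, hφ, h⟩ := hP.exists_formula
  have hP_iff (x : M.Num) :
      P x ↔ (φ.bindHead e).Realize M (Fin.cons x (assign (tailParams e) Fin.elim0)) η :=
    (h (Fin.cons x Fin.elim0)).trans (φ.realize_bindHead e x _ η).symm
  have ax := Fm.realize_of_sat_close M (hM.sat _ (.induction (φ.bindHead e) (hφ.subst _ _)))
    (assign (tailParams e) Fin.elim0) η
  simp only [Fm.realize_inductionAx, ← hP_iff] at ax
  exact ax ⟨zero, succ⟩ x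

theorem comprehension (P R : M.Num → Prop) [hP : SigmaRel fun v : Fin 1 → M.Num => P (v 0)]
    [hR : SigmaRel fun v : Fin 1 → M.Num => R (v 0)] (hPR : ∀ x, P x ↔ ¬ R x) :
    ∃ A : M.Sets, ∀ x, M.mem x A ↔ P x := by
  obtain ⟨l, m, φ, ψ, e, η, hφ, hψ, h⟩ := hP.exists_common Fm.Sigma1.subst hR
  have hP_iff (x : M.Num) :
      P x ↔ (φ.bindHead e).Realize M (Fin.cons x (assign (tailParams e) Fin.elim0)) η :=
    (h (Fin.cons x Fin.elim0)).1.trans (φ.realize_bindHead e x _ η).symm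
  have hR_iff (x : M.Num) :
      R x ↔ (ψ.bindHead e).Realize M (Fin.cons x (assign (tailParams e) Fin.elim0)) η :=
    (h (Fin.cons x Fin.elim0)).2.trans (ψ.realize_bindHead e x _ η).symm
  have ax := Fm.realize_of_sat_close M (hM.sat _ (.comprehension (φ.bindHead e) (ψ.bindHead e)
    (hφ.subst _ _) (hψ.subst _ _))) (assign (tailParams e) Fin.elim0) η
  simp only [comprehensionAx, Fm.imp, Fm.iff, Fm.Realize, Fm.realize_subst, Tm.eval,
    ← imp_iff_not_or, ← iff_def, Function.comp_def, Fin.cons_zero, Fin.cons_succ, ← hP_iff,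
    ← hR_iff] at ax
  exact ax hPR

end Axioms

end SOArith

namespace SOArith

/-! ### Arithmetic in models of `RCA₀` -/

namespace Str.Num

variable {M : Str.{u}}

instance : LE M.Num := ⟨fun x y => ∃ z, y = x + z⟩

variable [hM : IsModel M]

protected theorem add_zero (x : M.Num) : x + 0 = x := hM.sat _ (.robinson .q4) x

theorem succ_eq_add_one (x : M.Num) : M.succ x = x + 1 :=
  ((hM.sat _ (.robinson .q5) x 0 : x + 1 = M.succ (x + 0)).trans
    (congrArg M.succ (Num.add_zero x))).symm

theorem add_one_ne_zero (x : M.Num) : x + 1 ≠ 0 :=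
  succ_eq_add_one x ▸ hM.sat _ (.robinson .q1) x

theorem add_one_inj {x y : M.Num} (h : x + 1 = y + 1) : x = y :=
  imp_iff_not_or.2 (hM.sat _ (.robinson .q2) x y)
    (by rwa [← succ_eq_add_one, ← succ_eq_add_one] at h)

theorem exists_eq_add_one {x : M.Num} (h : x ≠ 0) : ∃ y, x = y + 1 := by
  have : ∃ y, x = M.succ y := imp_iff_not_or.2 (hM.sat _ (.robinson .q3) x) h
  simpa only [succ_eq_add_one] using this

theorem add_add_one (x y : M.Num) : x + (y + 1) = x + y + 1 := by
  have : x + M.succ y = M.succ (x + y) := hM.sat _ (.robinson .q5) x y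
  simpa only [succ_eq_add_one] using this

protected theorem mul_zero (x : M.Num) : x * 0 = 0 := hM.sat _ (.robinson .q6) x

theorem mul_add_one (x y : M.Num) : x * (y + 1) = x * y + x := by
  have : x * M.succ y = x * y + x := hM.sat _ (.robinson .q7) x y
  simpa only [succ_eq_add_one] using this

theorem lt_iff_exists_add_add_one (x y : M.Num) : x < y ↔ ∃ z, y = x + (z + 1) := by
  obtain ⟨h, h'⟩ := hM.sat _ (.robinson .q8) x y
  have : x < y ↔ ∃ z, x + M.succ z = y := ⟨imp_iff_not_or.2 h, imp_iff_not_or.2 h'⟩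
  simpa only [succ_eq_add_one, eq_comm] using this

@[elab_as_elim]
theorem induction {P : M.Num → Prop} [SigmaRel fun v : Fin 1 → M.Num => P (v 0)]
    (zero : P 0) (succ : ∀ x, P x → P (x + 1)) (x : M.Num) : P x :=
  succ_induction zero (fun x hx => succ_eq_add_one x ▸ succ x hx) x

protected theorem zero_add (x : M.Num) : 0 + x = x := by
  refine induction ?_ (fun x hx => ?_) x
  · exact Num.add_zero 0
  · rw [add_add_one, hx]

protected theorem add_assoc (x y z : M.Num) : x + y + z = x + (y + z) := by
  refine induction ?_ (fun z hz => ?_) z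
  · rw [Num.add_zero, Num.add_zero]
  · rw [add_add_one, add_add_one, add_add_one, hz]

theorem add_one_add (x y : M.Num) : x + 1 + y = x + y + 1 := by
  refine induction ?_ (fun y hy => ?_) y
  · rw [Num.add_zero, Num.add_zero]
  · rw [add_add_one, hy, add_add_one]

protected theorem add_comm (x y : M.Num) : x + y = y + x := by
  refine induction ?_ (fun y hy => ?_) y
  · rw [Num.add_zero, Num.zero_add]
  · rw [add_add_one, hy, add_one_add]

instance : AddCommMonoid M.Num where
  add_assoc := Num.add_assoc
  zero_add := Num.zero_add
  add_zero := Num.add_zero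
  add_comm := Num.add_comm
  nsmul := nsmulRec

protected theorem mul_add (x y z : M.Num) : x * (y + z) = x * y + x * z := by
  refine induction ?_ (fun z hz => ?_) z
  · rw [add_zero, Num.mul_zero, add_zero]
  · rw [add_add_one, mul_add_one, hz, mul_add_one, add_assoc]

protected theorem mul_assoc (x y z : M.Num) : x * y * z = x * (y * z) := by
  refine induction ?_ (fun z hz => ?_) z
  · simp only [Num.mul_zero]
  · rw [mul_add_one, hz, mul_add_one, Num.mul_add]

protected theorem zero_mul (x : M.Num) : 0 * x = 0 := by
  refine induction ?_ (fun x hx => ?_) x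
  · exact Num.mul_zero 0
  · rw [mul_add_one, hx, add_zero]

theorem add_one_mul (x y : M.Num) : (x + 1) * y = x * y + y := by
  refine induction ?_ (fun y hy => ?_) y
  · simp only [Num.mul_zero, add_zero]
  · rw [mul_add_one, hy, mul_add_one, add_add_one, add_add_one, add_right_comm _ y]

protected theorem mul_comm (x y : M.Num) : x * y = y * x := by
  refine induction ?_ (fun y hy => ?_) y
  · rw [Num.mul_zero, Num.zero_mul]
  · rw [mul_add_one, hy, add_one_mul]

protected theorem mul_one (x : M.Num) : x * 1 = x := by
  rw [← zero_add 1, mul_add_one, Num.mul_zero, zero_add]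

instance : CommSemiring M.Num where
  mul_assoc := Num.mul_assoc
  one_mul x := by rw [Num.mul_comm, Num.mul_one]
  mul_one := Num.mul_one
  left_distrib := Num.mul_add
  right_distrib x y z := by simp only [Num.mul_comm _ z, Num.mul_add]
  zero_mul := Num.zero_mul
  mul_zero := Num.mul_zero
  mul_comm := Num.mul_comm

instance : IsRightCancelAdd M.Num where
  add_right_cancel z x y :=
    induction (P := fun z => x + z = y + z → x = y) (by simp only [add_zero, imp_self])
      (fun z hz h => hz (add_one_inj (by simpa only [add_add_one] using h))) z

instance : IsCancelAdd M.Num := AddCommMagma.IsRightCancelAdd.toIsCancelAdd _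

theorem eq_zero_of_add_eq_zero {x y : M.Num} (h : x + y = 0) : y = 0 := by
  by_contra hy
  obtain ⟨z, rfl⟩ := exists_eq_add_one hy
  exact add_one_ne_zero (x + z) (by rw [← h, add_assoc])

protected theorem le_total (x y : M.Num) : x ≤ y ∨ y ≤ x := by
  suffices ∃ z, y = x + z ∨ x = y + z from exists_or.1 this
  refine induction ⟨x, .inr (zero_add x).symm⟩ (fun y hy => ?_) y
  · rcases hy with ⟨z, rfl | rfl⟩
    · exact ⟨z + 1, .inl (add_assoc _ _ _)⟩
    · rcases eq_or_ne z 0 with rfl | hz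
      · exact ⟨1, .inl (by rw [add_zero])⟩
      · obtain ⟨w, rfl⟩ := exists_eq_add_one hz
        exact ⟨w, .inr (by rw [add_assoc, add_comm 1])⟩

protected theorem le_antisymm {x y : M.Num} : x ≤ y → y ≤ x → x = y := by
  rintro ⟨z, rfl⟩ ⟨w, hw⟩
  have : w + z = 0 := by simpa only [add_assoc, left_eq_add, add_comm z] using hw
  rw [eq_zero_of_add_eq_zero this, add_zero]

protected theorem lt_iff_le_not_ge (x y : M.Num) : x < y ↔ x ≤ y ∧ ¬ y ≤ x := by
  rw [lt_iff_exists_add_add_one]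
  constructor
  · rintro ⟨z, rfl⟩
    refine ⟨⟨_, rfl⟩, fun ⟨w, hw⟩ => add_one_ne_zero (z + w) ?_⟩
    rw [add_right_comm]
    simpa only [add_assoc, left_eq_add] using hw
  · rintro ⟨⟨z, rfl⟩, h⟩
    have hz : z ≠ 0 := by
      rintro rfl
      exact h ⟨0, by simp only [add_zero]⟩
    obtain ⟨w, rfl⟩ := exists_eq_add_one hz
    exact ⟨w, rfl⟩

noncomputable instance : LinearOrder M.Num where
  le_refl x := ⟨0, (add_zero x).symm⟩
  le_trans := by
    rintro x _ _ ⟨z, rfl⟩ ⟨w, rfl⟩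
    exact ⟨z + w, add_assoc _ _ _⟩
  lt_iff_le_not_ge := Num.lt_iff_le_not_ge
  le_antisymm _ _ := Num.le_antisymm
  le_total := Num.le_total
  toDecidableLE := Classical.decRel _

instance : CanonicallyOrderedAdd M.Num where
  exists_add_of_le h := h
  le_add_self _ y := ⟨y, add_comm _ _⟩
  le_self_add _ y := ⟨y, rfl⟩

instance : IsOrderedCancelAddMonoid M.Num where
  add_le_add_left := by
    rintro x _ ⟨z, rfl⟩ w
    exact ⟨z, add_right_comm _ _ _⟩
  le_of_add_le_add_left := by
    rintro x y z ⟨w, hw⟩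
    exact ⟨w, add_left_cancel (hw.trans (add_assoc _ _ _))⟩

instance : Nontrivial M.Num := ⟨0, 1, fun h => add_one_ne_zero (0 : M.Num) (by rw [zero_add, ← h])⟩

theorem mul_lt_mul_of_pos_left {x y z : M.Num} (hx : 0 < x) (h : y < z) : x * y < x * z := by
  obtain ⟨w, rfl⟩ := (lt_iff_exists_add_add_one y z).1 h
  rw [mul_add, mul_add_one]
  exact lt_add_of_pos_right _ (add_pos_of_nonneg_of_pos zero_le hx)

instance : IsStrictOrderedRing M.Num where
  zero_le_one := zero_le
  mul_lt_mul_of_pos_left _ hx _ _ h := mul_lt_mul_of_pos_left hx h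
  mul_lt_mul_of_pos_right x hx y z h := by
    simpa only [mul_comm _ x] using mul_lt_mul_of_pos_left hx h

instance : SuccAddOrder M.Num where
  succ x := x + 1
  le_succ x := le_self_add
  max_of_succ_le h := (not_le_of_gt (lt_add_one _) h).elim
  succ_le_of_lt {x y} h := by
    obtain ⟨z, rfl⟩ := (lt_iff_exists_add_add_one x y).1 h
    exact ⟨z, by rw [add_assoc, add_comm 1]⟩
  succ_eq_add_one _ := rfl

end Str.Num

end SOArith

namespace SOArith

/-! ### Definable functions into finite sets -/

section BoundedFun

variable {M : Str.{u}} {n : ℕ} {S T : Type*}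

/-- The functions into a finite set whose fibres are given by bounded formulae. -/
class BoundedFun (f : (Fin n → M.Num) → S) : Prop where
  fiber : ∀ s, BoundedRel fun v => f v = s

instance BoundedRel.fiber (f : (Fin n → M.Num) → S) (s : S) [hf : BoundedFun f] :
    BoundedRel fun v => f v = s :=
  hf.fiber s

instance BoundedFun.const (s : S) : BoundedFun (M := M) (n := n) fun _ => s :=
  ⟨fun _ => inferInstance⟩

theorem BoundedRel.preimage [Finite S] (U : S → Prop) (f : (Fin n → M.Num) → S) [BoundedFun f] :
    BoundedRel fun v => U (f v) := by
  have : BoundedRel fun v => ∃ s, f v = s ∧ U s := inferInstance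
  simpa only [exists_eq_left'] using this

instance BoundedFun.pair (f : (Fin n → M.Num) → S) (g : (Fin n → M.Num) → T) [BoundedFun f]
    [BoundedFun g] : BoundedFun fun v => (f v, g v) := by
  refine ⟨fun s => ?_⟩
  simp only [Prod.ext_iff]
  infer_instance

instance BoundedRel.eq_fun [Finite S] (f g : (Fin n → M.Num) → S) [BoundedFun f] [BoundedFun g] :
    BoundedRel fun v => f v = g v :=
  .preimage (fun p : S × S => p.1 = p.2) fun v => (f v, g v)

theorem BoundedFun.map [Finite S] (h : S → T) (f : (Fin n → M.Num) → S) [BoundedFun f] :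
    BoundedFun fun v => h (f v) :=
  ⟨fun t => .preimage (fun s => h s = t) f⟩

theorem BoundedFun.map₂ {U : Type*} [Finite S] [Finite T] (h : S → T → U)
    (f : (Fin n → M.Num) → S) (g : (Fin n → M.Num) → T) [BoundedFun f] [BoundedFun g] :
    BoundedFun fun v => h (f v) (g v) :=
  .map (fun p : S × T => h p.1 p.2) fun v => (f v, g v)

instance BoundedFun.ite (P : (Fin n → M.Num) → Prop) [∀ v, Decidable (P v)]
    (f g : (Fin n → M.Num) → S) [BoundedRel P] [BoundedFun f] [BoundedFun g] :
    BoundedFun fun v => if P v then f v else g v := by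
  refine ⟨fun s => ?_⟩
  simp only [ite_eq_iff]
  infer_instance

instance BoundedFun.setOf [Finite S] (P : S → (Fin n → M.Num) → Prop) [∀ s, BoundedRel (P s)] :
    BoundedFun fun v => {s | P s v} := by
  refine ⟨fun s => ?_⟩
  simp only [Set.ext_iff, Set.mem_ofPred_eq]
  infer_instance

end BoundedFun

section Coding

variable {M : Str.{u}} [hM : IsModel M] {n : ℕ}

/-! ### Pairs and finite sets as numbers -/

instance BoundedRel.le (f g : (Fin n → M.Num) → M.Num) [TermFun f] [TermFun g] :
    BoundedRel fun v => f v ≤ g v := by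
  simp only [← not_lt]
  infer_instance

theorem Str.Num.dvd_iff_exists_lt (x y : M.Num) : x ∣ y ↔ ∃ z, z < y + 1 ∧ y = x * z := by
  refine ⟨fun ⟨z, h⟩ => ?_, fun ⟨z, _, h⟩ => ⟨z, h⟩⟩
  rcases eq_or_ne x 0 with rfl | hx
  · exact ⟨0, Order.lt_add_one_iff.2 zero_le, by rw [h, zero_mul, zero_mul]⟩
  · exact ⟨z, Order.lt_add_one_iff.2 (h ▸ le_mul_of_one_le_left zero_le
      (Order.one_le_iff_pos.2 (pos_iff_ne_zero.2 hx))), h⟩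

instance BoundedRel.dvd (f g : (Fin n → M.Num) → M.Num) [TermFun f] [TermFun g] :
    BoundedRel fun v => f v ∣ g v := by
  simp only [Str.Num.dvd_iff_exists_lt]
  infer_instance

/-- The pairing function `(x + y)² + x`, injective but not surjective. -/
def pair (x y : M.Num) : M.Num := (x + y) * (x + y) + x

instance TermFun.pair (f g : (Fin n → M.Num) → M.Num) [TermFun f] [TermFun g] :
    TermFun fun v => pair (f v) (g v) := by
  unfold SOArith.pair
  infer_instance

theorem pair_le_pair {x y x' y' : M.Num} (hx : x ≤ x') (hy : y ≤ y') : pair x y ≤ pair x' y' := by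
  unfold pair
  gcongr

theorem pair_lt_pair_of_add_lt_add {x y x' y' : M.Num} (h : x + y < x' + y') :
    pair x y < pair x' y' := by
  obtain ⟨z, hz⟩ := (Str.Num.lt_iff_exists_add_add_one _ _).1 h
  unfold pair
  rw [hz, Str.Num.lt_iff_exists_add_add_one]
  exact ⟨z * z + 2 * z * (x + y) + 2 * z + y + (x + y) + x', by ring⟩

theorem pair_inj {x y x' y' : M.Num} : pair x y = pair x' y' ↔ x = x' ∧ y = y' := by
  refine ⟨fun h => ?_, fun ⟨hx, hy⟩ => hx ▸ hy ▸ rfl⟩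
  rcases lt_trichotomy (x + y) (x' + y') with hlt | hadd | hlt
  · exact absurd h (pair_lt_pair_of_add_lt_add hlt).ne
  · obtain rfl : x = x' := by
      unfold pair at h
      rw [hadd] at h
      exact add_left_cancel h
    exact ⟨rfl, add_left_cancel hadd⟩
  · exact absurd h (pair_lt_pair_of_add_lt_add hlt).ne'

theorem left_le_pair (x y : M.Num) : x ≤ pair x y :=
  le_add_self

theorem right_le_pair (x y : M.Num) : y ≤ pair x y := by
  rcases eq_or_ne y 0 with rfl | hy
  · exact zero_le
  · obtain ⟨z, rfl⟩ := Str.Num.exists_eq_add_one hy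
    exact ⟨(x + z) * (x + z) + x + x + z + x, by unfold pair; ring⟩

/-- `i` is an element of the finite set that Gödel's `β` function assigns to `a` and `b`. -/
def InCode (a b i : M.Num) : Prop := 1 + (i + 1) * b ∣ a

instance BoundedRel.inCode (f g h : (Fin n → M.Num) → M.Num) [TermFun f] [TermFun g] [TermFun h] :
    BoundedRel fun v => InCode (f v) (g v) (h v) := by
  unfold InCode
  infer_instance

theorem Str.Num.dvd_of_dvd_add {d x y : M.Num} (h : d ∣ x + y) (hx : d ∣ x) : d ∣ y := by
  obtain ⟨a, rfl⟩ := hx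
  obtain ⟨b, hb⟩ := h
  rcases le_total a b with ⟨c, rfl⟩ | ⟨c, rfl⟩
  · exact ⟨c, add_left_cancel (hb.trans (mul_add _ _ _))⟩
  · have : d * b + (d * c + y) = d * b + 0 := by rw [← add_assoc, ← mul_add, hb, add_zero]
    rw [eq_zero_of_add_eq_zero (add_left_cancel this)]
    exact dvd_zero _

theorem exists_pos_forall_dvd (n : M.Num) : ∃ b : M.Num, 0 < b ∧ ∀ i, i < n → i + 1 ∣ b := by
  refine Str.Num.induction ⟨1, one_pos, fun i hi => absurd hi not_lt_zero⟩ ?_ n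
  rintro n ⟨b, hb, h⟩
  refine ⟨b * (n + 1), mul_pos hb (pos_iff_ne_zero.2 (Str.Num.add_one_ne_zero n)), fun i hi => ?_⟩
  rcases (Order.lt_add_one_iff.1 hi).lt_or_eq with hi | rfl
  · exact (h i hi).mul_right _
  · exact dvd_mul_left _ _

/-- The moduli `1 + (i + 1) * b` and `1 + (j + 1) * b` are coprime, as their difference
`(d + 1) * b` divides a power of `b`. -/
theorem InCode.of_mul {a b i j n : M.Num} (hb : ∀ i, i < n → i + 1 ∣ b) (hi : i < n)
    (hj : j < n) (hij : i ≠ j) (h : InCode (a * (1 + (j + 1) * b)) b i) : InCode a b i := by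
  unfold InCode at *
  set u := 1 + (i + 1) * b with hu
  obtain ⟨d, hd, h₁⟩ : ∃ d, d < n ∧ u ∣ a * (d + 1) * b := by
    rcases hij.lt_or_gt with hij | hij
    · obtain ⟨d, rfl⟩ := (Str.Num.lt_iff_exists_add_add_one _ _).1 hij
      refine ⟨d, (Order.add_one_le_iff.1 le_add_self).trans hj,
        Str.Num.dvd_of_dvd_add (x := a * u) ?_ (dvd_mul_left _ _)⟩
      convert h using 1
      rw [hu]
      ring
    · obtain ⟨d, rfl⟩ := (Str.Num.lt_iff_exists_add_add_one _ _).1 hij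
      refine ⟨d, (Order.add_one_le_iff.1 le_add_self).trans hi,
        Str.Num.dvd_of_dvd_add ⟨a, ?_⟩ h⟩
      rw [hu]
      ring
  have h₂ : u ∣ a * b * b := by
    obtain ⟨k, hk⟩ := hb d hd
    calc u ∣ a * (d + 1) * b * k := h₁.mul_right k
      _ = a * ((d + 1) * k) * b := by ring
      _ = a * b * b := by rw [← hk]
  have h₃ : u ∣ a * b :=
    Str.Num.dvd_of_dvd_add (x := a * b * b * (i + 1)) ⟨a * b, by rw [hu]; ring⟩ (h₂.mul_right _)
  exact Str.Num.dvd_of_dvd_add (x := a * b * (i + 1)) ⟨a, by rw [hu]; ring⟩ (h₃.mul_right _)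

theorem not_inCode_one {b : M.Num} (hb : 0 < b) (i : M.Num) : ¬ InCode 1 b i := by
  rintro ⟨z, hz⟩
  have hz₀ : 0 < z := pos_iff_ne_zero.2 fun h => one_ne_zero (by rw [hz, h, mul_zero])
  have hb : 0 < (i + 1) * b := mul_pos (pos_iff_ne_zero.2 (Str.Num.add_one_ne_zero i)) hb
  have hle : 1 + (i + 1) * b ≤ (1 + (i + 1) * b) * z :=
    le_mul_of_one_le_right zero_le (Order.one_le_iff_pos.2 hz₀)
  exact (lt_add_of_pos_right 1 hb).not_ge (hle.trans hz.ge)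

theorem comprehension_of_boundedRel (P : M.Num → Prop)
    [BoundedRel fun v : Fin 1 → M.Num => P (v 0)] : ∃ A : M.Sets, ∀ x, M.mem x A ↔ P x :=
  comprehension P (fun x => ¬ P x) fun _ => not_not.symm

theorem exists_inCode_iff (P : M.Num → Prop) [BoundedRel fun v : Fin 1 → M.Num => P (v 0)]
    (n : M.Num) : ∃ a b : M.Num, ∀ i, i < n → (InCode a b i ↔ P i) := by
  obtain ⟨b, hb₀, hb⟩ := exists_pos_forall_dvd n
  obtain ⟨A, hA⟩ := comprehension_of_boundedRel P
  suffices h : ∀ y, ∃ a, ∀ i, i < n → (InCode a b i ↔ i < y ∧ M.mem i A) by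
    obtain ⟨a, ha⟩ := h n
    exact ⟨a, b, fun i hi => by rw [ha i hi, and_iff_right hi, hA]⟩
  refine Str.Num.induction ⟨1, fun i _ => ?_⟩ fun y => ?_
  · exact iff_of_false (not_inCode_one hb₀ i) fun h => not_lt_zero h.1
  rintro ⟨a, ha⟩
  by_cases hy : y < n ∧ M.mem y A
  · refine ⟨a * (1 + (y + 1) * b), fun i hi => ?_⟩
    rcases eq_or_ne i y with rfl | hiy
    · exact iff_of_true (dvd_mul_left _ _) ⟨lt_add_one _, hy.2⟩
    · rw [Order.lt_add_one_iff, hiy.le_iff_lt, ← ha i hi]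
      exact ⟨.of_mul hb hi hy.1 hiy, fun h => h.mul_right _⟩
  · refine ⟨a, fun i hi => (ha i hi).trans ?_⟩
    rw [Order.lt_add_one_iff]
    refine and_congr_left fun h => ⟨le_of_lt, fun hiy => hiy.lt_of_ne ?_⟩
    rintro rfl
    exact hy ⟨hi, h⟩

/-! ### Functions into finite sets that belong to the model -/

variable {S : Type*}

/-- The functions into a finite set whose fibres are sets of the model. -/
class Coded (f : M.Num → S) : Prop where
  exists_fiber : ∀ s, ∃ A : M.Sets, ∀ x, M.mem x A ↔ f x = s

/-- The binary functions into a finite set whose fibres are sets (of pairs) of the model. -/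
class Coded₂ (f : M.Num → M.Num → S) : Prop where
  exists_fiber : ∀ s, ∃ A : M.Sets, ∀ x y, M.mem (pair x y) A ↔ f x y = s

instance BoundedFun.coded (f : M.Num → S) (t : (Fin n → M.Num) → M.Num) [hf : Coded f]
    [TermFun t] : BoundedFun fun v => f (t v) := by
  refine ⟨fun s => ?_⟩
  obtain ⟨A, hA⟩ := hf.exists_fiber s
  simp only [← hA]
  infer_instance

instance BoundedFun.coded₂ (f : M.Num → M.Num → S) (t t' : (Fin n → M.Num) → M.Num)
    [hf : Coded₂ f] [TermFun t] [TermFun t'] : BoundedFun fun v => f (t v) (t' v) := by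
  refine ⟨fun s => ?_⟩
  obtain ⟨A, hA⟩ := hf.exists_fiber s
  simp only [← hA]
  infer_instance

instance BoundedRel.coded (P : M.Num → Prop) (t : (Fin n → M.Num) → M.Num) [Coded P]
    [TermFun t] : BoundedRel fun v => P (t v) :=
  .preimage id fun v => P (t v)

theorem Coded.of_boundedFun {f : M.Num → S}
    (_ : BoundedFun fun v : Fin 1 → M.Num => f (v 0)) : Coded f :=
  ⟨fun s => comprehension_of_boundedRel fun x => f x = s⟩

theorem Coded.of_boundedRel {P : M.Num → Prop}
    (h : BoundedRel fun v : Fin 1 → M.Num => P (v 0)) : Coded P :=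
  .of_boundedFun ⟨fun p => by
    simpa only [eq_iff_iff] using BoundedRel.iff (hP := h) _ fun _ => p⟩

instance Coded₂.left (f : M.Num → M.Num → S) [Coded₂ f] (x : M.Num) : Coded (f x) :=
  .of_boundedFun inferInstance

/-- The variables are ordered as they are after two existential quantifiers over `x` and `y` in a
context with a single variable. -/
theorem comprehension₂ (P R : M.Num → M.Num → Prop)
    [SigmaRel fun w : Fin 3 → M.Num => P (w (Fin.succ 0)) (w 0)]
    [SigmaRel fun w : Fin 3 → M.Num => R (w (Fin.succ 0)) (w 0)] (hPR : ∀ x y, P x y ↔ ¬ R x y) :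
    ∃ A : M.Sets, ∀ x y, M.mem (pair x y) A ↔ P x y := by
  obtain ⟨A, hA⟩ := comprehension (fun p => ∃ x y, p = pair x y ∧ P x y)
    (fun p => (¬ ∃ x, x < p + 1 ∧ ∃ y, y < p + 1 ∧ p = pair x y) ∨ ∃ x y, p = pair x y ∧ R x y)
    fun p => by
      by_cases hp : ∃ x y, p = pair x y
      · obtain ⟨x, y, rfl⟩ := hp
        have bounded : ∃ x', x' < pair x y + 1 ∧ ∃ y', y' < pair x y + 1 ∧ pair x y = pair x' y' :=
          ⟨x, Order.lt_add_one_iff.2 (left_le_pair x y), y,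
            Order.lt_add_one_iff.2 (right_le_pair x y), rfl⟩
        simp only [bounded, not_true, false_or]
        simp only [pair_inj, and_assoc, exists_and_left, exists_eq_left', hPR]
      · push Not at hp
        simp only [hp, false_and, and_false, exists_false, not_false_eq_true, true_or, not_true]
  refine ⟨A, fun x y => ?_⟩
  simp only [hA, pair_inj, and_assoc, exists_and_left, exists_eq_left']

theorem Coded.of_sigmaRel [Finite S] {f : M.Num → S}
    (h : ∀ s, SigmaRel fun v : Fin 1 → M.Num => f (v 0) = s) : Coded f :=
  ⟨fun s => comprehension (fun x => f x = s) (fun x => ∃ t, t ≠ s ∧ f x = t) fun x => by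
    simp only [exists_eq_right', not_not]⟩

theorem Coded₂.of_sigmaRel [Finite S] {f : M.Num → M.Num → S}
    (h : ∀ s, SigmaRel fun w : Fin 3 → M.Num => f (w (Fin.succ 0)) (w 0) = s) : Coded₂ f :=
  ⟨fun s => comprehension₂ (fun x y => f x y = s) (fun x y => ∃ t, t ≠ s ∧ f x y = t) fun x y => by
    simp only [exists_eq_right', not_not]⟩

theorem Str.Num.le_induction {P : M.Num → Prop} [BoundedRel fun v : Fin 1 → M.Num => P (v 0)]
    {k : M.Num} (base : P k) (succ : ∀ x, k ≤ x → P x → P (x + 1)) {x : M.Num} (hx : k ≤ x) :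
    P x := by
  refine Num.induction (P := fun x => k ≤ x → P x) (fun h => ?_) (fun x ih h => ?_) x hx
  · exact nonpos_iff_eq_zero.1 h ▸ base
  · rcases h.lt_or_eq with h | rfl
    · exact succ x (Order.lt_add_one_iff.1 h) (ih (Order.lt_add_one_iff.1 h))
    · exact base

theorem Coded.le_induction [Finite S] (f : M.Num → S) [Coded f] (U : S → Prop) {k : M.Num}
    (base : U (f k)) (succ : ∀ x, k ≤ x → U (f x) → U (f (x + 1))) {x : M.Num} (hx : k ≤ x) :
    U (f x) :=
  have : BoundedRel fun v : Fin 1 → M.Num => U (f (v 0)) := .preimage U _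
  Str.Num.le_induction (P := fun x => U (f x)) base succ hx

/-! ### Recursion into a finite set -/

section Recursion

variable [Finite S]

/-- The name of an element of a finite set in a model. -/
noncomputable def index (s : S) : M.Num := ((Finite.equivFin S s : ℕ) : M.Num)

theorem index_inj {s t : S} : (index s : M.Num) = index t ↔ s = t := by
  unfold index
  rw [Nat.cast_inj, Fin.val_inj, EmbeddingLike.apply_eq_iff_eq]

theorem index_le (s : S) : (index s : M.Num) ≤ (Nat.card S : M.Num) :=
  Nat.cast_le.2 (Finite.equivFin S s).2.le

/-- The value at `i` of the finite sequence coded by `a` and `b`; junk if the set coded by `a` and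
`b` does not contain exactly one of the pairs `(i, s)`. -/
noncomputable def decode [Nonempty S] (a b i : M.Num) : S :=
  Classical.epsilon fun s => s ∈ {s | InCode a b (pair i (index s))}

instance BoundedFun.decode [Nonempty S] (f g h : (Fin n → M.Num) → M.Num) [TermFun f] [TermFun g]
    [TermFun h] : BoundedFun fun v => (decode (f v) (g v) (h v) : S) :=
  .map (fun U : Set S => Classical.epsilon fun s => s ∈ U) _

theorem exists_decode_eq [Nonempty S] (f : M.Num → S) [Coded f] (x : M.Num) :
    ∃ a b, ∀ i, i ≤ x → decode a b i = f i := by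
  obtain ⟨a, b, h⟩ := exists_inCode_iff
    (fun p => ∃ i, i < p + 1 ∧ ∃ s, p = pair i (index s) ∧ f i = s)
    (pair x (Nat.card S : M.Num) + 1)
  refine ⟨a, b, fun i hi => ?_⟩
  have fiber (s : S) : InCode a b (pair i (index s)) ↔ f i = s := by
    rw [h _ (Order.lt_add_one_iff.2 (pair_le_pair hi (index_le s)))]
    constructor
    · rintro ⟨j, -, t, hjt, hj⟩
      obtain ⟨rfl, hst⟩ := pair_inj.1 hjt
      exact hj.trans (index_inj.1 hst).symm
    · exact fun hs => ⟨i, Order.lt_add_one_iff.2 (left_le_pair _ _), s, rfl, hs⟩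
  have mem : decode a b i ∈ {s | InCode a b (pair i (index s))} :=
    Classical.epsilon_spec (p := (· ∈ {s | InCode a b (pair i (index s))})) ⟨f i, (fiber _).2 rfl⟩
  exact ((fiber _).1 mem).symm

variable (G : M.Num → M.Num → S → S) (s₀ : S)

/-- `a` and `b` code the values up to `x` of the function that is defined by recursion from `s₀`
and `G y`. -/
def IsComp (a b y x : M.Num) : Prop :=
  have : Nonempty S := ⟨s₀⟩
  decode a b 0 = s₀ ∧ ∀ i, i < x → decode a b (i + 1) = G y i (decode a b i)

variable {G s₀}

instance BoundedRel.isComp [hG : Coded₂ G] (f g h k : (Fin n → M.Num) → M.Num) [TermFun f]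
    [TermFun g] [TermFun h] [TermFun k] :
    BoundedRel fun v => IsComp G s₀ (f v) (g v) (h v) (k v) := by
  have : Nonempty S := ⟨s₀⟩
  have apply {m : ℕ} (F : (Fin m → M.Num) → S → S) (s : (Fin m → M.Num) → S) [BoundedFun F]
      [BoundedFun s] : BoundedFun fun v => F v (s v) := .map₂ (fun F s => F s) F s
  unfold IsComp
  infer_instance

theorem IsComp.mono {a b y x x' : M.Num} (h : IsComp G s₀ a b y x) (hx : x' ≤ x) :
    IsComp G s₀ a b y x' :=
  ⟨h.1, fun i hi => h.2 i (hi.trans_le hx)⟩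

theorem IsComp.decode_eq [Nonempty S] {a b a' b' y x : M.Num} (h : IsComp G s₀ a b y x)
    (h' : IsComp G s₀ a' b' y x) : (decode a b x : S) = decode a' b' x := by
  refine Str.Num.induction (P := fun i => i ≤ x → (decode a b i : S) = decode a' b' i)
    (fun _ => h.1.trans h'.1.symm) (fun i ih hi => ?_) x le_rfl
  have hix : i < x := Order.add_one_le_iff.1 hi
  exact (h.2 i hix).trans ((congrArg (G y i) (ih hix.le)).trans (h'.2 i hix).symm)

theorem exists_isComp [Coded₂ G] (s₀ : S) (y x : M.Num) : ∃ a b, IsComp G s₀ a b y x := by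
  have : Nonempty S := ⟨s₀⟩
  refine Str.Num.induction ?_ ?_ x
  · have : Coded fun _ : M.Num => s₀ := .of_boundedFun inferInstance
    obtain ⟨a, b, h⟩ := exists_decode_eq (fun _ : M.Num => s₀) 0
    exact ⟨a, b, h 0 le_rfl, fun i hi => absurd hi not_lt_zero⟩
  · rintro x ⟨a, b, h⟩
    let f (i : M.Num) : S := if i ≤ x then decode a b i else G y x (decode a b x)
    have : Coded f := .of_boundedFun inferInstance
    obtain ⟨a', b', h'⟩ := exists_decode_eq f (x + 1)
    have decode_eq {i : M.Num} (hi : i ≤ x) : (decode a' b' i : S) = decode a b i :=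
      (h' i (hi.trans le_self_add)).trans (if_pos hi)
    refine ⟨a', b', (decode_eq zero_le).trans h.1, fun i hi => ?_⟩
    have hi := Order.lt_add_one_iff.1 hi
    refine .trans ?_ (congrArg (G y i) (decode_eq hi)).symm
    rcases hi.lt_or_eq with hi | rfl
    · exact (decode_eq (Order.add_one_le_of_lt hi)).trans (h.2 i hi)
    · exact (h' _ le_rfl).trans (if_neg (lt_add_one i).not_ge)

theorem exists_rec₂ (G : M.Num → M.Num → S → S) [Coded₂ G] (s₀ : S) :
    ∃ f : M.Num → M.Num → S, Coded₂ f ∧ (∀ y, f y 0 = s₀) ∧ ∀ y x, f y (x + 1) = G y x (f y x) := by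
  have : Nonempty S := ⟨s₀⟩
  choose a b h using exists_isComp (G := G) s₀
  refine ⟨fun y x => decode (a y x) (b y x) x, .of_sigmaRel fun s => ?_, fun y => (h y 0).1,
    fun y x => ?_⟩
  · have graph (y x : M.Num) : (decode (a y x) (b y x) x = s) ↔
        ∃ a' b', IsComp G s₀ a' b' y x ∧ decode a' b' x = s :=
      ⟨fun hs => ⟨_, _, h y x, hs⟩, fun ⟨_, _, h', hs⟩ => ((h y x).decode_eq h').trans hs⟩
    simp only [graph]
    infer_instance
  · have decode_eq := (h y x).decode_eq ((h y (x + 1)).mono le_self_add)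
    exact ((h y (x + 1)).2 x (lt_add_one x)).trans (congrArg (G y x) decode_eq.symm)

theorem exists_rec (G : M.Num → S → S) [Coded G] (s₀ : S) : ∃ f : M.Num → S, Coded f ∧ f 0 = s₀ ∧
    ∀ x, f (x + 1) = G x (f x) := by
  have : Coded₂ fun _ : M.Num => G := ⟨fun s => comprehension₂ _ (fun _ x => G x ≠ s)
    fun _ _ => not_not.symm⟩
  obtain ⟨f, _, h₀, h⟩ := exists_rec₂ (fun _ : M.Num => G) s₀
  exact ⟨f 0, .of_boundedFun inferInstance, h₀ 0, h 0⟩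

end Recursion

end Coding

end SOArith

namespace SOArith

/-! ### Infinite words and runs in a model -/

section Sequences

variable {M : Str.{u}}

theorem Fm.realize_disj {n m : ℕ} (l : List (Fm n m)) (ρ : Fin n → M.Num) (η : Fin m → M.Sets) :
    (Fm.disj l).Realize M ρ η ↔ ∃ φ ∈ l, φ.Realize M ρ η := by
  induction l with
  | nil => simp [Fm.disj, Fm.Realize]
  | cons φ l ih => simp [Fm.disj, Fm.Realize, ih]

theorem Tm.eval_pair {n : ℕ} (s t : Tm n) (ρ : Fin n → M.Num) :
    (s.pair t).eval M ρ = SOArith.pair (s.eval M ρ) (t.eval M ρ) := rfl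

variable [hM : IsModel M]

theorem Tm.eval_num {n : ℕ} (k : ℕ) (ρ : Fin n → M.Num) :
    (Tm.num k : Tm n).eval M ρ = (k : M.Num) := by
  induction k with
  | zero => exact Nat.cast_zero.symm
  | succ k ih => rw [Tm.num, Tm.eval, ih, Str.Num.succ_eq_add_one, Nat.cast_succ]

variable {α : Type*}

theorem Fm.realize_inFin [Finite α] (c : α → ℕ) (S : Set α) {n m : ℕ} (t : Tm n)
    (ρ : Fin n → M.Num) (η : Fin m → M.Sets) :
    (Fm.inFin c S t).Realize M ρ η ↔ ∃ s ∈ S, t.eval M ρ = (c s : M.Num) := by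
  simp [Fm.inFin, Fm.realize_disj, Fm.Realize, Tm.eval_num]

/-- The set `A` is the graph of `f`, where the values of `f` are coded by `c`. -/
def Represents (c : α → ℕ) (A : M.Sets) (f : M.Num → α) : Prop :=
  ∀ x y, M.mem (pair x y) A ↔ y = (c (f x) : M.Num)

theorem Fm.realize_isSeq [Finite α] (c : α → ℕ) {n m : ℕ} (X : Fin m)
    (ρ : Fin n → M.Num) (η : Fin m → M.Sets) :
    (Fm.isSeq c X).Realize M ρ η ↔ ∃ f, Represents c (η X) f := by
  simp only [Fm.isSeq, Fm.Realize, Fm.realize_inFin, Fm.app, Fm.imp, ← imp_iff_not_or,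
    Tm.eval_pair, Tm.eval]
  constructor
  · rintro ⟨total, unique⟩
    have (x : M.Num) : ∃ s, M.mem (SOArith.pair x (c s : M.Num)) (η X) := by
      obtain ⟨_, ⟨s, -, rfl⟩, h⟩ := total x
      exact ⟨s, h⟩
    choose f hf using this
    exact ⟨f, fun x y => ⟨fun h => unique x _ _ ⟨h, hf x⟩, fun h => h ▸ hf x⟩⟩
  · rintro ⟨f, hf⟩
    exact ⟨fun x => ⟨_, ⟨f x, Set.mem_univ _, rfl⟩, (hf x _).2 rfl⟩,
      fun x y z h => ((hf x y).1 h.1).trans ((hf x z).1 h.2).symm⟩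

theorem Represents.coded {c : α → ℕ} (hc : c.Injective) {A : M.Sets} {f : M.Num → α}
    (h : Represents c A f) : Coded f := by
  refine .of_boundedFun ⟨fun s => ?_⟩
  have fiber (x : M.Num) : f x = s ↔ M.mem (pair x (c s : M.Num)) A := by
    rw [h, Nat.cast_inj, hc.eq_iff, eq_comm]
  simp only [fiber]
  infer_instance

theorem Coded.exists_represents [Finite α] (c : α → ℕ) (f : M.Num → α) [Coded f] :
    ∃ A : M.Sets, Represents c A f := by
  obtain ⟨A, hA⟩ := comprehension₂ (M := M) (fun x y => ∃ s, f x = s ∧ y = (c s : M.Num))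
    (fun x y => ¬ ∃ s, f x = s ∧ y = (c s : M.Num)) fun _ _ => not_not.symm
  exact ⟨A, fun x y => by simp only [hA, exists_eq_left']⟩

end Sequences

end SOArith

namespace NBA

open SOArith

section Runs

variable {M : Str.{u}} [hM : IsModel M] {A Q : Type*}

open Filter in
/-- `r` is an accepting run of the automaton on the infinite word `w`. -/
structure IsAccRun (𝒜 : NBA A Q) (w : M.Num → A) (r : M.Num → Q) : Prop where
  zero : r 0 = 𝒜.q₀
  step : ∀ x, ((r x, w x), r (x + 1)) ∈ 𝒜.δ
  frequently : ∃ᶠ x in atTop, r x ∈ 𝒜.F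

variable [Finite A] [Finite Q]

theorem realize_inδ (𝒜 : NBA A Q) (cA : A → ℕ) (cQ : Q → ℕ) {n m : ℕ} (p a q : Tm n)
    (ρ : Fin n → M.Num) (η : Fin m → M.Sets) :
    (𝒜.inδ cA cQ p a q).Realize M ρ η ↔ ∃ e ∈ 𝒜.δ, p.eval M ρ = (cQ e.1.1 : M.Num) ∧
      a.eval M ρ = (cA e.1.2 : M.Num) ∧ q.eval M ρ = (cQ e.2 : M.Num) := by
  simp [inδ, Fm.realize_disj, Fm.Realize, Tm.eval_num]

theorem realize_inLang_iff_exists_represents (𝒜 : NBA A Q) {cA : A → ℕ} (hA : cA.Injective)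
    {cQ : Q → ℕ} (hQ : cQ.Injective) {n m : ℕ} (X : Fin m) (ρ : Fin n → M.Num)
    (η : Fin m → M.Sets) {w : M.Num → A} (hw : Represents cA (η X) w) :
    (𝒜.inLang cA cQ X).Realize M ρ η ↔ ∃ Y, ∃ r, Represents cQ Y r ∧ 𝒜.IsAccRun w r := by
  simp only [inLang, Fm.Realize, Fm.realize_isSeq]
  rw [and_iff_right ⟨w, hw⟩]
  refine exists_congr fun Y => ?_
  rw [← exists_and_right]
  refine exists_congr fun r => and_congr_right fun hr => ?_
  have mem_X (x y : M.Num) : M.mem (pair x y) (η X) ↔ y = (cA (w x) : M.Num) := hw x y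
  have mem_Y (x y : M.Num) : M.mem (pair x y) Y ↔ y = (cQ (r x) : M.Num) := hr x y
  have cons_two {k : ℕ} (x : M.Num) (v : Fin (k + 2) → M.Num) :
      (Fin.cons x v : Fin (k + 3) → M.Num) 2 = v 1 := rfl
  have cons_three {k : ℕ} (x : M.Num) (v : Fin (k + 3) → M.Num) :
      (Fin.cons x v : Fin (k + 4) → M.Num) 3 = v 2 := rfl
  simp only [Fm.realize_inFin, realize_inδ, Fm.app, Fm.Realize, Tm.eval_pair, Tm.eval, Tm.eval_num,
    Fin.cons_zero, Fin.cons_one, Fin.cons_succ, cons_two, cons_three, mem_X, mem_Y]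
  simp only [Nat.cast_inj, hA.eq_iff, hQ.eq_iff, ↓existsAndEq, Prod.exists, and_true, true_and,
    exists_eq_right_right', exists_eq_right']
  simp only [Str.Num.succ_eq_add_one]
  exact ⟨fun ⟨zero, step, frequently⟩ => ⟨zero.symm, step, Filter.frequently_atTop'.2 frequently⟩,
    fun h => ⟨h.zero.symm, h.step, Filter.frequently_atTop'.1 h.frequently⟩⟩

theorem realize_inLang (𝒜 : NBA A Q) {cA : A → ℕ} (hA : cA.Injective) {cQ : Q → ℕ}
    (hQ : cQ.Injective) {n m : ℕ} (X : Fin m) (ρ : Fin n → M.Num) (η : Fin m → M.Sets)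
    {w : M.Num → A} (hw : Represents cA (η X) w) :
    (𝒜.inLang cA cQ X).Realize M ρ η ↔ ∃ r : M.Num → Q, Coded r ∧ 𝒜.IsAccRun w r := by
  rw [𝒜.realize_inLang_iff_exists_represents hA hQ X ρ η hw]
  constructor
  · rintro ⟨Y, r, hY, hr⟩
    exact ⟨r, hY.coded hQ, hr⟩
  · rintro ⟨r, _, hr⟩
    obtain ⟨Y, hY⟩ := Coded.exists_represents cQ r
    exact ⟨Y, r, hY, hr⟩

end Runs

end NBA

namespace NBA

/-! ### The monoid of transition matrices -/

section Paths

variable {A Q : Type*} {𝒜 : NBA A Q} {a : A} {σ : List A} {q q' : Q}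

theorem isPath_cons {x : Fin ((a :: σ).length + 1) → Q} :
    𝒜.IsPath (a :: σ) q q' x ↔
      x 0 = q ∧ ((q, a), x 1) ∈ 𝒜.δ ∧ 𝒜.IsPath σ (x 1) q' fun i => x i.succ := by
  constructor
  · rintro ⟨rfl, last, step⟩
    exact ⟨rfl, step 0, rfl, last, fun i => step i.succ⟩
  · rintro ⟨rfl, first, -, last, step⟩
    refine ⟨rfl, last, fun i => ?_⟩
    exact Fin.cases (motive := fun i : Fin (σ.length + 1) =>
      ((x i.castSucc, (a :: σ).get i), x i.succ) ∈ 𝒜.δ) first step i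

theorem exists_isPath_cons_and (U : (Fin (σ.length + 1) → Q) → Prop) :
    (∃ x, 𝒜.IsPath (a :: σ) q q' x ∧ U fun i => x i.succ) ↔
      ∃ p, ((q, a), p) ∈ 𝒜.δ ∧ ∃ y, 𝒜.IsPath σ p q' y ∧ U y := by
  constructor
  · rintro ⟨x, hx, hU⟩
    obtain ⟨-, first, tail⟩ := isPath_cons.1 hx
    exact ⟨_, first, _, tail, hU⟩
  · rintro ⟨_, first, y, ⟨rfl, tail⟩, hU⟩
    exact ⟨Fin.cons q y, isPath_cons.2 ⟨rfl, first, rfl, tail⟩, hU⟩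

theorem exists_isPath_nil_and {U : (Fin 1 → Q) → Prop} :
    (∃ x, 𝒜.IsPath [] q q' x ∧ U x) ↔ q = q' ∧ U fun _ => q := by
  constructor
  · rintro ⟨x, ⟨rfl, rfl, -⟩, hU⟩
    exact ⟨rfl, (funext fun i => congrArg x (Subsingleton.elim (α := Fin 1) _ _)) ▸ hU⟩
  · rintro ⟨rfl, hU⟩
    exact ⟨_, ⟨rfl, rfl, fun i => i.elim0⟩, hU⟩

theorem transMatrix_pos : 0 < 𝒜.transMatrix σ q q' ↔ ∃ x, 𝒜.IsPath σ q q' x := by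
  unfold transMatrix
  split_ifs with hit path
  · simpa using hit.imp fun _ => And.left
  · simpa using path
  · simpa using path

theorem transMatrix_eq_top :
    𝒜.transMatrix σ q q' = ⊤ ↔ ∃ x, 𝒜.IsPath σ q q' x ∧ ∃ i, i ≠ 0 ∧ x i ∈ 𝒜.F := by
  unfold transMatrix
  split_ifs with hit <;> simp [hit]

theorem transMatrix_nil_pos : 0 < 𝒜.transMatrix [] q q' ↔ q = q' := by
  simpa only [transMatrix_pos, and_true] using exists_isPath_nil_and (𝒜 := 𝒜) (U := fun _ => True)

theorem transMatrix_nil_ne_top : 𝒜.transMatrix [] q q' ≠ ⊤ := by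
  rw [Ne, transMatrix_eq_top]
  rintro ⟨x, -, i, hi, -⟩
  exact hi (Subsingleton.elim (α := Fin 1) _ _)

theorem transMatrix_cons_pos :
    0 < 𝒜.transMatrix (a :: σ) q q' ↔ ∃ p, ((q, a), p) ∈ 𝒜.δ ∧ 0 < 𝒜.transMatrix σ p q' := by
  simpa only [transMatrix_pos, and_true] using exists_isPath_cons_and (𝒜 := 𝒜) fun _ => True

theorem transMatrix_cons_eq_top :
    𝒜.transMatrix (a :: σ) q q' = ⊤ ↔ ∃ p, ((q, a), p) ∈ 𝒜.δ ∧
      (p ∈ 𝒜.F ∧ 0 < 𝒜.transMatrix σ p q' ∨ 𝒜.transMatrix σ p q' = ⊤) := by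
  have hit_cons (x : Fin (σ.length + 2) → Q) :
      (∃ i, i ≠ 0 ∧ x i ∈ 𝒜.F) ↔ ∃ i : Fin (σ.length + 1), x i.succ ∈ 𝒜.F := by
    simp [Fin.exists_fin_succ (n := σ.length + 1)]
  refine transMatrix_eq_top.trans <|
    (exists_congr fun x => and_congr_right fun _ => hit_cons x).trans <|
    (exists_isPath_cons_and fun y => ∃ i, y i ∈ 𝒜.F).trans ?_
  refine exists_congr fun p => and_congr_right fun _ => ?_
  rw [transMatrix_pos, transMatrix_eq_top, ← exists_and_left, ← exists_or]
  refine exists_congr fun y => ?_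
  have hit_iff (hy : 𝒜.IsPath σ p q' y) :
      (∃ i, y i ∈ 𝒜.F) ↔ p ∈ 𝒜.F ∨ ∃ i, i ≠ 0 ∧ y i ∈ 𝒜.F := by
    simp [Fin.exists_fin_succ, hy.1]
  tauto

theorem transMatrix_singleton_pos : 0 < 𝒜.transMatrix [a] q q' ↔ ((q, a), q') ∈ 𝒜.δ := by
  simp only [transMatrix_cons_pos, transMatrix_nil_pos, exists_eq_right]

theorem transMatrix_singleton_eq_top :
    𝒜.transMatrix [a] q q' = ⊤ ↔ ((q, a), q') ∈ 𝒜.δ ∧ q' ∈ 𝒜.F := by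
  simp [transMatrix_cons_eq_top, transMatrix_nil_pos, transMatrix_nil_ne_top]

end Paths

section Composition

variable {Q : Type*} {β γ : Q → Q → ℕ∞} {q q' : Q}

theorem comp_pos : 0 < comp β γ q q' ↔ ∃ p, 0 < β q p ∧ 0 < γ p q' := by
  simp only [comp, lt_iSup_iff, pos_iff_ne_zero, mul_ne_zero_iff]

theorem comp_assoc (β γ ζ : Q → Q → ℕ∞) : comp (comp β γ) ζ = comp β (comp γ ζ) := by
  funext q q'
  simp only [comp, ENat.iSup_mul, ENat.mul_iSup, mul_assoc]
  exact iSup_comm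

variable [Finite Q]

theorem exists_comp_eq_mul (β γ : Q → Q → ℕ∞) (q q' : Q) :
    ∃ p, comp β γ q q' = β q p * γ p q' := by
  have : Nonempty Q := ⟨q⟩
  exact (exists_eq_ciSup_of_finite (f := fun p => β q p * γ p q')).imp fun _ => Eq.symm

theorem comp_eq_top :
    comp β γ q q' = ⊤ ↔ ∃ p, β q p = ⊤ ∧ 0 < γ p q' ∨ 0 < β q p ∧ γ p q' = ⊤ := by
  have mul_eq_top (p : Q) : β q p * γ p q' = ⊤ ↔
      β q p = ⊤ ∧ 0 < γ p q' ∨ 0 < β q p ∧ γ p q' = ⊤ := by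
    rw [pos_iff_ne_zero, pos_iff_ne_zero, or_comm]
    exact WithTop.mul_eq_top_iff
  simp only [← mul_eq_top]
  constructor
  · intro h
    obtain ⟨p, hp⟩ := exists_comp_eq_mul β γ q q'
    exact ⟨p, hp.symm.trans h⟩
  · rintro ⟨p, hp⟩
    exact top_unique (hp ▸ le_iSup (fun p => β q p * γ p q') p)

end Composition

section Entries

/-- The entries `0`, `1` and `∞` of transition matrices. -/
def entries : Set ℕ∞ := {0, 1, ⊤}

theorem eq_of_mem_entries {a b : ℕ∞} (ha : a ∈ entries) (hb : b ∈ entries)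
    (pos_iff : 0 < a ↔ 0 < b) (top_iff : a = ⊤ ↔ b = ⊤) : a = b := by
  rcases ha with rfl | rfl | rfl <;> rcases hb with rfl | rfl | rfl <;> simp_all

theorem mul_mem_entries {a b : ℕ∞} (ha : a ∈ entries) (hb : b ∈ entries) : a * b ∈ entries := by
  rcases ha with rfl | rfl | rfl <;> rcases hb with rfl | rfl | rfl <;> simp [entries]

variable {A Q : Type*} {𝒜 : NBA A Q}

theorem transMatrix_mem_entries (σ : List A) (q q' : Q) : 𝒜.transMatrix σ q q' ∈ entries := by
  unfold transMatrix entries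
  split_ifs <;> simp

theorem transMatrix_nil [DecidableEq Q] (q q' : Q) :
    𝒜.transMatrix [] q q' = if q = q' then 1 else 0 := by
  have mem : (if q = q' then 1 else 0 : ℕ∞) ∈ entries := by split_ifs <;> simp [entries]
  refine eq_of_mem_entries (transMatrix_mem_entries _ _ _) mem ?_ ?_
  · rw [transMatrix_nil_pos]
    split_ifs with h <;> simp [h]
  · simp [transMatrix_nil_ne_top, ite_eq_iff]

theorem nil_comp (β : Q → Q → ℕ∞) : comp (𝒜.transMatrix []) β = β := by
  classical
  funext q q'
  have ite_mul_eq_iSup (p : Q) : (if q = p then 1 else 0) * β p q' = ⨆ _ : q = p, β p q' := by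
    rw [ite_mul, one_mul, zero_mul, iSup_eq_if, bot_eq_zero]
  simp only [comp, transMatrix_nil, ite_mul_eq_iSup, iSup_iSup_eq_right]

theorem comp_nil (β : Q → Q → ℕ∞) : comp β (𝒜.transMatrix []) = β := by
  classical
  funext q q'
  have mul_ite_eq_iSup (p : Q) : β q p * (if p = q' then 1 else 0) = ⨆ _ : p = q', β q p := by
    rw [mul_ite, mul_one, mul_zero, iSup_eq_if, bot_eq_zero]
  simp only [comp, transMatrix_nil, mul_ite_eq_iSup, iSup_iSup_eq_left]

variable [Finite Q]

theorem transMatrix_cons (a : A) (σ : List A) :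
    𝒜.transMatrix (a :: σ) = comp (𝒜.transMatrix [a]) (𝒜.transMatrix σ) := by
  funext q q'
  have mem : comp (𝒜.transMatrix [a]) (𝒜.transMatrix σ) q q' ∈ entries := by
    obtain ⟨p, hp⟩ := exists_comp_eq_mul (𝒜.transMatrix [a]) (𝒜.transMatrix σ) q q'
    exact hp ▸ mul_mem_entries (transMatrix_mem_entries _ _ _) (transMatrix_mem_entries _ _ _)
  refine eq_of_mem_entries (transMatrix_mem_entries _ _ _) mem ?_ ?_
  · simp only [transMatrix_cons_pos, comp_pos, transMatrix_nil_pos, exists_eq_right]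
  · simp only [transMatrix_cons_eq_top (σ := σ), comp_eq_top,
      transMatrix_singleton_pos, transMatrix_singleton_eq_top]
    refine exists_congr fun p => ?_
    tauto

theorem transMatrix_append (σ τ : List A) :
    𝒜.transMatrix (σ ++ τ) = comp (𝒜.transMatrix σ) (𝒜.transMatrix τ) := by
  induction σ with
  | nil => rw [List.nil_append, nil_comp]
  | cons a σ ih => rw [List.cons_append, transMatrix_cons, ih, transMatrix_cons a σ, comp_assoc]

end Entries

section Monoid

variable {A Q : Type*} {𝒜 : NBA A Q}

/-- The transition matrix of a letter. -/
noncomputable def letter (𝒜 : NBA A Q) (a : A) : 𝒜.Mat := ⟨𝒜.transMatrix [a], [a], rfl⟩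

theorem letter_pos {a : A} {q q' : Q} : 0 < (𝒜.letter a).1 q q' ↔ ((q, a), q') ∈ 𝒜.δ :=
  transMatrix_singleton_pos

theorem letter_eq_top {a : A} {q q' : Q} :
    (𝒜.letter a).1 q q' = ⊤ ↔ ((q, a), q') ∈ 𝒜.δ ∧ q' ∈ 𝒜.F :=
  transMatrix_singleton_eq_top

variable [Finite Q]

noncomputable instance : Monoid 𝒜.Mat where
  one := ⟨𝒜.transMatrix [], [], rfl⟩
  mul β γ := ⟨comp β.1 γ.1, by
    obtain ⟨_, σ, rfl⟩ := β
    obtain ⟨_, τ, rfl⟩ := γ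
    exact ⟨σ ++ τ, transMatrix_append σ τ⟩⟩
  mul_assoc β γ ζ := Subtype.ext (comp_assoc β.1 γ.1 ζ.1)
  one_mul β := Subtype.ext (nil_comp β.1)
  mul_one β := Subtype.ext (comp_nil β.1)

theorem Mat.one_pos {q q' : Q} : 0 < (1 : 𝒜.Mat).1 q q' ↔ q = q' := transMatrix_nil_pos

theorem Mat.one_ne_top {q q' : Q} : (1 : 𝒜.Mat).1 q q' ≠ ⊤ := transMatrix_nil_ne_top

theorem Mat.mul_pos {β γ : 𝒜.Mat} {q q' : Q} :
    0 < (β * γ).1 q q' ↔ ∃ p, 0 < β.1 q p ∧ 0 < γ.1 p q' := comp_pos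

theorem Mat.mul_eq_top {β γ : 𝒜.Mat} {q q' : Q} : (β * γ).1 q q' = ⊤ ↔
    ∃ p, β.1 q p = ⊤ ∧ 0 < γ.1 p q' ∨ 0 < β.1 q p ∧ γ.1 p q' = ⊤ := comp_eq_top

theorem rejecting_iff {β γ : 𝒜.Mat} : 𝒜.Rejecting β.1 γ.1 ↔
    β * γ = β ∧ γ * γ = γ ∧ ∀ q, 0 < β.1 𝒜.q₀ q → γ.1 q q < ⊤ := by
  have ext_iff (μ ν : 𝒜.Mat) : μ = ν ↔ μ.1 = ν.1 := Subtype.ext_iff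
  rw [ext_iff, ext_iff]
  rfl

end Monoid

end NBA

namespace SOArith

/-! ### Products and Ramsey's theorem for additive colourings -/

open Filter

section Ramsey

variable {M : Str.{u}} [hM : IsModel M] {T : Type*}

theorem Str.Num.exists_isLeast (P : M.Num → Prop) [BoundedRel fun v : Fin 1 → M.Num => P (v 0)]
    (h : ∃ x, P x) : ∃ x, IsLeast {x | P x} x := by
  have : Coded P := .of_boundedRel inferInstance
  by_contra! no_least
  have not_lt (n : M.Num) : ∀ x, x < n → ¬ P x := by
    refine Num.induction (P := fun n => ∀ x, x < n → ¬ P x) (fun x hx => absurd hx not_lt_zero)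
      (fun n ih x hx hP => ?_) n
    rcases (Order.lt_add_one_iff.1 hx).lt_or_eq with hx | rfl
    · exact ih x hx hP
    · exact no_least x ⟨hP, fun y hy => not_lt.1 fun hyx => ih y hyx hy⟩
  obtain ⟨x, hx⟩ := h
  exact not_lt (x + 1) x (lt_add_one x) hx

/-- Two starting points are identified if the products from them are eventually equal. -/
noncomputable def tailSetoid (c : M.Num → M.Num → T) : Setoid M.Num := (germSetoid atTop T).comap c

/-- If `c x y` is the product of the letters from `x` to `y`, the positions in `H` factorise
the word as `β γ γ γ …`, except that between two of them the product is required to be `γ` only if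
the second one is large enough with respect to the first. -/
structure WeaklyHomogeneous (c : M.Num → M.Num → T) (H : M.Num → Prop) (β γ : T) : Prop where
  frequently : ∃ᶠ y in atTop, H y
  initial : ∀ y, H y → 0 < y ∧ c 0 y = β
  eventually : ∀ x, H x → ∀ᶠ y in atTop, H y → c x y = γ

theorem WeaklyHomogeneous.exists_next {c : M.Num → M.Num → T} {H : M.Num → Prop} {β γ : T}
    (h : WeaklyHomogeneous c H β γ) {x : M.Num} (hx : H x) : ∃ y, H y ∧ x < y ∧ c x y = γ := by
  obtain ⟨y, hy, hxy, hcxy⟩ :=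
    (h.frequently.and_eventually ((eventually_gt_atTop x).and (h.eventually x hx))).exists
  exact ⟨y, hy, hxy, hcxy hy⟩

/-- If `c x y` is the product of the letters from `x` to `y`, the positions in `P` factorise
the word as `β γ γ γ …`. -/
structure Homogeneous (c : M.Num → M.Num → T) (P : M.Num → Prop) (β γ : T) : Prop where
  frequently : ∃ᶠ x in atTop, P x
  initial : ∀ x, P x → c 0 x = β
  between : ∀ x y, P x → P y → x < y → c x y = γ

/-- `ρ x` is the product from `x` up to the first position in `P` that is not before `x`. -/
def IsLookahead (c : M.Num → M.Num → T) (P : M.Num → Prop) (ρ : M.Num → T) : Prop :=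
  ∀ x, ∃ z, IsLeast {z | x ≤ z ∧ P z} z ∧ ρ x = c x z

theorem exists_isLookahead [Finite T] (c : M.Num → M.Num → T) [Coded₂ c] (P : M.Num → Prop)
    [Coded P] (hP : ∃ᶠ x in atTop, P x) : ∃ ρ, Coded ρ ∧ IsLookahead c P ρ := by
  have (x : M.Num) : ∃ z, IsLeast {z | x ≤ z ∧ P z} z :=
    Str.Num.exists_isLeast _ ((eventually_ge_atTop x).and_frequently hP).exists
  choose next hnext using this
  refine ⟨fun x => c x (next x), .of_sigmaRel fun t => ?_, fun x => ⟨next x, hnext x, rfl⟩⟩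
  have fiber (x : M.Num) : c x (next x) = t ↔
      ∃ z, ((x ≤ z ∧ P z) ∧ ∀ y, y < z → ¬ (x ≤ y ∧ P y)) ∧ c x z = t := by
    constructor
    · exact fun h => ⟨next x, ⟨(hnext x).1, fun y hy h => hy.not_ge ((hnext x).2 h)⟩, h⟩
    · rintro ⟨z, ⟨hz, hlt⟩, h⟩
      have : IsLeast {z | x ≤ z ∧ P z} z := ⟨hz, fun y hy => not_lt.1 fun h => hlt y h hy⟩
      rwa [(hnext x).unique this]
  simp only [fiber]
  infer_instance

variable [Monoid T]

/-- `c x y` is the product of the values of `u` in the interval `[x, y)`. -/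
structure IsProd (u : M.Num → T) (c : M.Num → M.Num → T) : Prop where
  self : ∀ x, c x x = 1
  succ : ∀ x y, x ≤ y → c x (y + 1) = c x y * u y

/-- The factor that is appended to the product over `[x, y)`; the recursion on `y` starts at `0`, so
the product stays `1` until `y` reaches `x`. -/
noncomputable def appendFactor (u : M.Num → T) (x y : M.Num) : T → T :=
  if y < x then fun _ => 1 else fun s => s * u y

theorem exists_isProd [Finite T] (u : M.Num → T) [Coded u] : ∃ c, Coded₂ c ∧ IsProd u c := by
  have : Coded₂ (appendFactor u) := by
    refine .of_sigmaRel fun s => ?_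
    have (f g : (Fin 3 → M.Num) → M.Num) [TermFun f] [TermFun g] :
        BoundedFun fun v => appendFactor u (f v) (g v) := by
      have : BoundedFun fun v => fun s : T => s * u (g v) := .map (fun t s : T => s * t) _
      unfold appendFactor
      infer_instance
    infer_instance
  obtain ⟨c, hc, zero, succ⟩ := exists_rec₂ (appendFactor u) 1
  refine ⟨c, hc, fun x => ?_, fun x y hxy => ?_⟩
  · rcases eq_or_ne x 0 with rfl | hx
    · exact zero 0
    · obtain ⟨z, rfl⟩ := Str.Num.exists_eq_add_one hx
      rw [succ, appendFactor, if_pos (lt_add_one z)]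
  · rw [succ, appendFactor, if_neg hxy.not_gt]

variable {u : M.Num → T} {c : M.Num → M.Num → T}

theorem IsProd.self_succ (hc : IsProd u c) (x : M.Num) : c x (x + 1) = u x := by
  rw [hc.succ x x le_rfl, hc.self, one_mul]

theorem IsLookahead.of_mem {P : M.Num → Prop} {ρ : M.Num → T}
    (hρ : IsLookahead c P ρ) (hc : IsProd u c) {x : M.Num} (hx : P x) : ρ x = 1 := by
  obtain ⟨z, hz, hρx⟩ := hρ x
  rw [hρx, le_antisymm (hz.2 ⟨le_rfl, hx⟩) hz.1.1, hc.self]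

variable [Finite T] [Coded₂ c]

namespace IsProd

theorem le_induction {S : Type*} [Finite S] (hc : IsProd u c) (f : M.Num → S) [Coded f]
    (U : S → T → Prop) {x k : M.Num} (hx : x ≤ k) (base : U (f k) (c x k))
    (succ : ∀ y, k ≤ y → U (f y) (c x y) → U (f (y + 1)) (c x y * u y)) {y : M.Num}
    (hy : k ≤ y) : U (f y) (c x y) := by
  have : Coded fun y => (f y, c x y) := .of_boundedFun inferInstance
  refine Coded.le_induction (fun y => (f y, c x y)) (fun p => U p.1 p.2) base
    (fun y hky ih => ?_) hy
  simpa only [hc.succ x y (hx.trans hky)] using succ y hky ih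

theorem mul (hc : IsProd u c) {x y z : M.Num} (hxy : x ≤ y) (hyz : y ≤ z) :
    c x y * c y z = c x z := by
  refine hc.le_induction (c y) (fun s t => c x y * s = t) hxy ?_ (fun n hn ih => ?_) hyz
  · rw [hc.self, mul_one]
  · rw [hc.succ y n hn, ← mul_assoc, ih]

theorem eq_mul_succ (hc : IsProd u c) {x y : M.Num} (hxy : x < y) : c x y = u x * c (x + 1) y := by
  rw [← hc.mul (lt_add_one x).le (Order.add_one_le_of_lt hxy), hc.self_succ]

theorem eventuallyEq_iff (hc : IsProd u c) {x y : M.Num} :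
    c x =ᶠ[atTop] c y ↔ ∃ z, (x ≤ z ∧ y ≤ z) ∧ c x z = c y z := by
  constructor
  · intro h
    exact (((eventually_ge_atTop x).and (eventually_ge_atTop y)).and h).exists
  · rintro ⟨z, ⟨hx, hy⟩, h⟩
    filter_upwards [eventually_ge_atTop z] with w hw
    rw [← hc.mul hx hw, ← hc.mul hy hw, h]

end IsProd

/-- Finitely many pairwise inequivalent points have pairwise distinct products up to a common upper
bound, so there are at most as many as elements of `T`. -/
theorem IsProd.finite_quotient (hc : IsProd u c) : Finite (Quotient (tailSetoid c)) := by
  classical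
  cases nonempty_fintype T
  refine @Fintype.finite _ (fintypeOfFinsetCardLe (Fintype.card T) fun s => ?_)
  obtain ⟨b, hb⟩ := (s.image Quotient.out).exists_le
  simp only [Finset.forall_mem_image] at hb
  refine Finset.card_le_card_of_injOn (fun C => c C.out b) (fun _ _ => Finset.mem_univ _) ?_
  intro C hC D hD h
  exact Quotient.out_equiv_out.1 (hc.eventuallyEq_iff.2 ⟨b, ⟨hb hC, hb hD⟩, h⟩)

theorem IsProd.coded_quotient_mk (hc : IsProd u c) : Coded (Quotient.mk (tailSetoid c)) := by
  have := hc.finite_quotient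
  refine .of_sigmaRel fun C => ?_
  induction C using Quotient.inductionOn with | _ x
  have mk_eq (y : M.Num) : Quotient.mk (tailSetoid c) y = Quotient.mk _ x ↔
      ∃ z, (y ≤ z ∧ x ≤ z) ∧ c y z = c x z :=
    Quotient.eq.trans hc.eventuallyEq_iff
  simp only [mk_eq]
  infer_instance

namespace WeaklyHomogeneous

variable {H : M.Num → Prop} {β γ : T}

theorem left_mul_right (h : WeaklyHomogeneous c H β γ) (hc : IsProd u c) : β * γ = β := by
  obtain ⟨x, hx⟩ := h.frequently.exists
  obtain ⟨y, hy, hxy, hcxy⟩ := h.exists_next hx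
  rw [← hcxy, ← (h.initial x hx).2, hc.mul zero_le hxy.le, (h.initial y hy).2, (h.initial x hx).2]

theorem right_mul_self (h : WeaklyHomogeneous c H β γ) (hc : IsProd u c) : γ * γ = γ := by
  obtain ⟨x, hx⟩ := h.frequently.exists
  obtain ⟨y, hy, hxy, hcxy⟩ := h.exists_next hx
  obtain ⟨z, hz, hyz, hcxz, hcyz⟩ := (h.frequently.and_eventually
    ((eventually_gt_atTop y).and ((h.eventually x hx).and (h.eventually y hy)))).exists
  calc γ * γ = c x y * c y z := by rw [hcxy, hcyz hz]
    _ = γ := by rw [hc.mul hxy.le hyz.le, hcxz hz]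

end WeaklyHomogeneous

/-- The positions are chosen from a class of `tailSetoid c` that contains arbitrarily large ones, so
that the products from any two of them are eventually equal. -/
theorem IsProd.exists_weaklyHomogeneous (hc : IsProd u c) :
    ∃ (H : M.Num → Prop) (β γ : T), Coded H ∧ WeaklyHomogeneous c H β γ := by
  have := hc.finite_quotient
  have := hc.coded_quotient_mk
  obtain ⟨C, hC⟩ : ∃ C, ∃ᶠ y in atTop, Quotient.mk (tailSetoid c) y = C :=
    frequently_exists.1 (Frequently.of_forall fun y => ⟨_, rfl⟩)
  obtain ⟨x₀, rfl⟩ := C.exists_rep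
  obtain ⟨γ, hγ⟩ : ∃ γ, ∃ᶠ y in atTop,
      (Quotient.mk (tailSetoid c) y = Quotient.mk _ x₀ ∧ x₀ < y) ∧ c x₀ y = γ :=
    frequently_exists.1 ((hC.and_eventually (eventually_gt_atTop x₀)).mono fun y h => ⟨_, h, rfl⟩)
  refine ⟨_, c 0 x₀ * γ, γ, .of_boundedRel inferInstance, hγ, ?_, ?_⟩
  · rintro y ⟨⟨-, hy⟩, hcy⟩
    exact ⟨zero_le.trans_lt hy, by rw [← hcy, hc.mul zero_le hy.le]⟩
  · rintro x ⟨⟨hx, -⟩, -⟩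
    filter_upwards [Quotient.exact hx] with y hxy hy
    exact hxy.trans hy.2

namespace IsLookahead

variable {P : M.Num → Prop} {ρ : M.Num → T}

theorem exists_succ (hρ : IsLookahead c P ρ) (hc : IsProd u c) (x : M.Num) :
    ∃ z, (P z ∧ x < z) ∧ u x * ρ (x + 1) = c x z := by
  obtain ⟨z, hz, hρx⟩ := hρ (x + 1)
  have hxz : x < z := (lt_add_one x).trans_le hz.1.1
  exact ⟨z, ⟨hz.1.2, hxz⟩, by rw [hρx, hc.eq_mul_succ hxz]⟩

theorem of_notMem (hρ : IsLookahead c P ρ) (hc : IsProd u c) {x : M.Num} (hx : ¬ P x) :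
    ρ x = u x * ρ (x + 1) := by
  obtain ⟨z, ⟨⟨hxz, hz⟩, hmin⟩, hρx⟩ := hρ x
  obtain ⟨z', hz', hρx'⟩ := hρ (x + 1)
  have hlt : x < z := hxz.lt_of_ne fun h => hx (h ▸ hz)
  have : IsLeast {z | x + 1 ≤ z ∧ P z} z := ⟨⟨Order.add_one_le_of_lt hlt, hz⟩, fun y hy =>
    hmin ⟨(lt_add_one x).le.trans hy.1, hy.2⟩⟩
  rw [hρx, hρx', hz'.unique this, hc.eq_mul_succ hlt]

end IsLookahead

end Ramsey

end SOArith

namespace NBA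

/-! ### Runs along a homogeneous factorisation -/

open SOArith Filter

section Runs

variable {A Q : Type*} {𝒜 : NBA A Q}

/-- A word with matrix `μ` can be read from `p` to `q`, with a visit to `F` unless `b` holds. -/
def Reaches (μ : 𝒜.Mat) (b : Prop) (p q : Q) : Prop := 0 < μ.1 p q ∧ (b ∨ μ.1 p q = ⊤)

theorem Reaches.of_pos {μ : 𝒜.Mat} {p q : Q} (h : 0 < μ.1 p q) : Reaches μ True p q :=
  ⟨h, .inl trivial⟩

theorem Reaches.of_eq_top {μ : 𝒜.Mat} {p q : Q} (h : μ.1 p q = ⊤) (b : Prop) : Reaches μ b p q :=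
  ⟨h ▸ ENat.top_pos, .inr h⟩

variable [Finite Q] {M : Str.{u}} [hM : IsModel M] {w : M.Num → A} {c : M.Num → M.Num → 𝒜.Mat}
  {P : M.Num → Prop} {β γ : 𝒜.Mat}

section Necessity

variable {r : M.Num → Q} [Coded₂ c] [Coded r]

theorem pos_of_step (hc : IsProd (fun x => 𝒜.letter (w x)) c)
    (hr : ∀ x, ((r x, w x), r (x + 1)) ∈ 𝒜.δ) {x y : M.Num} (hxy : x ≤ y) :
    0 < (c x y).1 (r x) (r y) := by
  refine hc.le_induction r (fun p μ => 0 < μ.1 (r x) p) le_rfl ?_ (fun n _ ih => ?_) hxy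
  · rw [hc.self]
    exact Mat.one_pos.2 rfl
  · exact Mat.mul_pos.2 ⟨r n, ih, letter_pos.2 (hr n)⟩

theorem eq_top_of_step (hc : IsProd (fun x => 𝒜.letter (w x)) c)
    (hr : ∀ x, ((r x, w x), r (x + 1)) ∈ 𝒜.δ) {x y z : M.Num} (hxy : x < y) (hyz : y ≤ z)
    (hy : r y ∈ 𝒜.F) : (c x z).1 (r x) (r z) = ⊤ := by
  obtain ⟨k, rfl⟩ := Str.Num.exists_eq_add_one ((zero_le.trans_lt hxy).ne')
  have hxk : x ≤ k := Order.lt_add_one_iff.1 hxy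
  have top : (c x (k + 1)).1 (r x) (r (k + 1)) = ⊤ := by
    rw [hc.succ x k hxk]
    exact Mat.mul_eq_top.2 ⟨r k, .inr ⟨pos_of_step hc hr hxk, letter_eq_top.2 ⟨hr k, hy⟩⟩⟩
  rw [← hc.mul hxy.le hyz]
  exact Mat.mul_eq_top.2 ⟨r (k + 1), .inl ⟨top, pos_of_step hc hr hyz⟩⟩

theorem exists_eq_top_of_isAccRun (hc : IsProd (fun x => 𝒜.letter (w x)) c)
    (h : Homogeneous c P β γ) (hr : 𝒜.IsAccRun w r) :
    ∃ q, 0 < β.1 𝒜.q₀ q ∧ γ.1 q q = ⊤ := by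
  obtain ⟨q, hq⟩ : ∃ q, ∃ᶠ x in atTop, P x ∧ r x = q :=
    frequently_exists.1 (h.frequently.mono fun x hx => ⟨_, hx, rfl⟩)
  obtain ⟨x, hx, hxq⟩ := hq.exists
  obtain ⟨y, hy, hxy⟩ := (hr.frequently.and_eventually (eventually_gt_atTop x)).exists
  obtain ⟨z, ⟨hz, hzq⟩, hyz⟩ := (hq.and_eventually (eventually_ge_atTop y)).exists
  refine ⟨q, ?_, ?_⟩
  · have := pos_of_step hc hr.step (zero_le (a := x))
    rwa [h.initial x hx, hr.zero, hxq] at this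
  · have := eq_top_of_step hc hr.step hxy hyz hy
    rwa [h.between x z hx hz (hxy.trans_le hyz), hxq, hzq] at this

end Necessity

theorem reaches_one_iff {b : Prop} {p q : Q} : Reaches (1 : 𝒜.Mat) b p q ↔ p = q ∧ b := by
  rw [Reaches, Mat.one_pos, or_iff_left Mat.one_ne_top]

theorem Reaches.exists_step {a : A} {ρ : 𝒜.Mat} {b : Prop} {p q : Q}
    (h : Reaches (𝒜.letter a * ρ) b p q) :
    ∃ p', ((p, a), p') ∈ 𝒜.δ ∧ Reaches ρ (b ∨ p' ∈ 𝒜.F) p' q := by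
  obtain ⟨pos, hb | top⟩ := h
  · obtain ⟨p', hpp', hp'q⟩ := Mat.mul_pos.1 pos
    exact ⟨p', letter_pos.1 hpp', hp'q, .inl (.inl hb)⟩
  · obtain ⟨p', ⟨hpp', hp'q⟩ | ⟨hpp', hp'q⟩⟩ := Mat.mul_eq_top.1 top
    · obtain ⟨step, mem⟩ := letter_eq_top.1 hpp'
      exact ⟨p', step, hp'q, .inl (.inr mem)⟩
    · exact ⟨p', letter_pos.1 hpp', .of_eq_top hp'q _⟩

/-- `g` chooses transitions that keep `q` within reach, given the next letter, the matrix of the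
remaining word and whether a visit to `F` has already been made. -/
def IsGuide (𝒜 : NBA A Q) (q : Q) (g : A → 𝒜.Mat → Q → Prop → Q) : Prop :=
  ∀ a ρ p b, Reaches (𝒜.letter a * ρ) b p q →
    ((p, a), g a ρ p b) ∈ 𝒜.δ ∧ Reaches ρ (b ∨ g a ρ p b ∈ 𝒜.F) (g a ρ p b) q

theorem exists_isGuide (𝒜 : NBA A Q) (q : Q) : ∃ g, IsGuide 𝒜 q g := by
  have (a : A) (ρ : 𝒜.Mat) (p : Q) (b : Prop) : ∃ p', Reaches (𝒜.letter a * ρ) b p q →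
      ((p, a), p') ∈ 𝒜.δ ∧ Reaches ρ (b ∨ p' ∈ 𝒜.F) p' q := by
    by_cases h : Reaches (𝒜.letter a * ρ) b p q
    · exact h.exists_step.imp fun _ h' _ => h'
    · exact ⟨p, fun h' => absurd h' h⟩
  choose g hg using this
  exact ⟨g, hg⟩

/-- The run `r` follows the guide `g`, where `ρ` gives the matrices of the remaining words up to the
next position in `P`, and `b x` tells whether `F` has been visited since the last position in `P`
(or whether there is no such position). -/
structure IsGuidedRun (w : M.Num → A) (g : A → 𝒜.Mat → Q → Prop → Q) (P : M.Num → Prop)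
    (ρ : M.Num → 𝒜.Mat) (r : M.Num → Q) (b : M.Num → Prop) : Prop where
  zero : r 0 = 𝒜.q₀
  flag_zero : b 0
  succ : ∀ x, r (x + 1) = g (w x) (ρ (x + 1)) (r x) (b x)
  flag_succ : ∀ x, b (x + 1) ↔ ¬ P (x + 1) ∧ (b x ∨ r (x + 1) ∈ 𝒜.F)

variable {ρ : M.Num → 𝒜.Mat} {g : A → 𝒜.Mat → Q → Prop → Q} {r : M.Num → Q} {b : M.Num → Prop}
  {q : Q}

theorem exists_isGuidedRun [Finite A] [Coded w] [Coded P] [Coded ρ]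
    (g : A → 𝒜.Mat → Q → Prop → Q) :
    ∃ r b, Coded r ∧ Coded b ∧ IsGuidedRun w g P ρ r b := by
  let advance (t : A × 𝒜.Mat × Prop) (s : Q × Prop) : Q × Prop :=
    (g t.1 t.2.1 s.1 s.2, ¬ t.2.2 ∧ (s.2 ∨ g t.1 t.2.1 s.1 s.2 ∈ 𝒜.F))
  have : Coded fun x => advance (w x, ρ (x + 1), P (x + 1)) := .of_boundedFun (.map advance _)
  obtain ⟨f, _, zero, succ⟩ :=
    exists_rec (fun x => advance (w x, ρ (x + 1), P (x + 1))) (𝒜.q₀, True)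
  refine ⟨fun x => (f x).1, fun x => (f x).2, .of_boundedFun (.map Prod.fst _),
    .of_boundedFun (.map Prod.snd _), ?_, ?_, fun x => ?_, fun x => ?_⟩
  · rw [zero]
  · rw [zero]
    trivial
  · rw [succ]
  · rw [succ]

namespace IsGuidedRun

theorem reaches [Coded₂ c] [Coded w] [Coded r] [Coded b] [Coded ρ] [Finite A]
    (h : IsGuidedRun w g P ρ r b) (hg : IsGuide 𝒜 q g) (hρ : IsLookahead c P ρ)
    (hc : IsProd (fun x => 𝒜.letter (w x)) c) (hP : Homogeneous c P β γ)
    (hβ : 0 < β.1 𝒜.q₀ q) (hγ : γ.1 q q = ⊤) (x : M.Num) :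
    Reaches (𝒜.letter (w x) * ρ (x + 1)) (b x) (r x) q := by
  have : Coded fun x => (w x, ρ (x + 1), b x, r x) := .of_boundedFun inferInstance
  refine Coded.le_induction (fun x => (w x, ρ (x + 1), b x, r x))
    (fun s => Reaches (𝒜.letter s.1 * s.2.1) s.2.2.1 s.2.2.2 q) ?_ (fun x _ ih => ?_) zero_le
  · obtain ⟨z, ⟨hz, -⟩, hcz⟩ := hρ.exists_succ hc 0
    simp only [hcz, hP.initial z hz, h.zero, h.flag_zero]
    exact .of_pos hβ
  · have next := (hg _ _ _ _ ih).2
    simp only [← h.succ] at next ⊢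
    by_cases hx : P (x + 1)
    · rw [hρ.of_mem hc hx, reaches_one_iff] at next
      obtain ⟨z, ⟨hz, hxz⟩, hcz⟩ := hρ.exists_succ hc (x + 1)
      rw [hcz, hP.between _ _ hx hz hxz, next.1]
      exact .of_eq_top hγ _
    · rw [hρ.of_notMem hc hx] at next
      rwa [eq_iff_iff.2 (h.flag_succ x), eq_true hx, true_and]

omit [Finite Q] in
theorem frequently [Coded b] (h : IsGuidedRun w g P ρ r b) (hP : ∃ᶠ x in atTop, P x)
    (visit : ∀ x, P (x + 1) → b x ∨ r (x + 1) ∈ 𝒜.F) : ∃ᶠ x in atTop, r x ∈ 𝒜.F := by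
  by_contra no_visit
  obtain ⟨N, hN⟩ := eventually_atTop.1 (not_frequently.1 no_visit)
  obtain ⟨m, hm, hNm⟩ := (hP.and_eventually (eventually_gt_atTop N)).exists
  obtain ⟨n, hn, hmn⟩ := (hP.and_eventually (eventually_gt_atTop m)).exists
  obtain ⟨m, rfl⟩ := Str.Num.exists_eq_add_one ((zero_le.trans_lt hNm).ne')
  obtain ⟨n, rfl⟩ := Str.Num.exists_eq_add_one ((zero_le.trans_lt hmn).ne')
  have hmn' : m + 1 ≤ n := Order.lt_add_one_iff.1 hmn
  have not_flag : ¬ b n := by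
    refine Coded.le_induction b Not ?_ (fun x hx hbx => ?_) hmn'
    · exact fun hb => ((h.flag_succ m).1 hb).1 hm
    · exact fun hb => ((h.flag_succ x).1 hb).2.elim hbx
        (hN _ (hNm.le.trans (hx.trans (lt_add_one x).le)))
  exact (visit n hn).elim not_flag (hN _ (hNm.trans hmn).le)

end IsGuidedRun

/-- The run of `𝒜` passes through `q` at the positions in `P`. -/
theorem exists_isAccRun_of_eq_top [Finite A] [Coded w] [Coded₂ c] [Coded P]
    (hc : IsProd (fun x => 𝒜.letter (w x)) c) (h : Homogeneous c P β γ)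
    (hβ : 0 < β.1 𝒜.q₀ q) (hγ : γ.1 q q = ⊤) : ∃ r : M.Num → Q, Coded r ∧ 𝒜.IsAccRun w r := by
  obtain ⟨g, hg⟩ := exists_isGuide 𝒜 q
  obtain ⟨ρ, _, hρ⟩ := exists_isLookahead c P h.frequently
  obtain ⟨r, b, _, _, hr⟩ := exists_isGuidedRun (w := w) (P := P) (ρ := ρ) g
  have step (x : M.Num) := hg _ _ _ _ (hr.reaches hg hρ hc h hβ hγ x)
  simp only [← hr.succ] at step
  refine ⟨r, inferInstance, hr.zero, fun x => (step x).1, ?_⟩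
  refine hr.frequently h.frequently fun x hx => ?_
  have := (step x).2
  rw [hρ.of_mem hc hx, reaches_one_iff] at this
  exact this.2

theorem exists_isAccRun_iff [Finite A] [Coded w] [Coded₂ c] [Coded P]
    (hc : IsProd (fun x => 𝒜.letter (w x)) c) (h : Homogeneous c P β γ) :
    (∃ r : M.Num → Q, Coded r ∧ 𝒜.IsAccRun w r) ↔ ∃ q, 0 < β.1 𝒜.q₀ q ∧ γ.1 q q = ⊤ := by
  constructor
  · rintro ⟨r, _, hr⟩
    exact exists_eq_top_of_isAccRun hc h hr
  · rintro ⟨q, hβ, hγ⟩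
    exact exists_isAccRun_of_eq_top hc h hβ hγ

end Runs

end NBA

namespace NBA

/-! ### Runs of the complement automaton -/

open SOArith Filter

variable {A Q : Type*} {𝒜 : NBA A Q} {a : A} {s s' : 𝒜.ComplState} {β γ ζ ξ : 𝒜.Mat}
  {M : Str.{u}} [hM : IsModel M] {w : M.Num → A} {c : M.Num → M.Num → 𝒜.Mat}
  {H : M.Num → Prop} {Z : M.Num → 𝒜.ComplState}

theorem complStep_init_iff : 𝒜.ComplStep .init a s ↔
    ∃ β γ : 𝒜.Mat, 𝒜.Rejecting β.1 γ.1 ∧ s = .three β γ (𝒜.letter a) := by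
  constructor
  · rintro ⟨_, β, γ, ζ, hrej, hζ⟩
    exact ⟨β, γ, hrej, congrArg _ (Subtype.ext hζ)⟩
  · rintro ⟨β, γ, hrej, rfl⟩
    exact .start _ _ _ _ hrej rfl

theorem complStep_one_iff : 𝒜.ComplStep (.one γ) a s ↔
    s = .two γ (𝒜.letter a) ∨ s = .one γ ∧ 𝒜.letter a = γ := by
  constructor
  · rintro (_ | _ | _ | ⟨_, _, ζ, h⟩ | _ | _ | ⟨_, _, h⟩)
    · exact .inl (congrArg _ (Subtype.ext h))
    · exact .inr ⟨rfl, Subtype.ext h⟩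
  · rintro (rfl | ⟨rfl, rfl⟩)
    · exact .oneStep _ _ _ rfl
    · exact .oneDone _ _ rfl

/-- `Z` is a run of `𝒜ᶜ` that starts by guessing the pair `(β, γ)`, except that this pair need not
be rejecting. -/
structure IsGuess (w : M.Num → A) (β γ : 𝒜.Mat) (Z : M.Num → 𝒜.ComplState) : Prop where
  zero : Z 0 = .init
  one : Z 1 = .three β γ (𝒜.letter (w 0))
  step : ∀ x, 0 < x → 𝒜.ComplStep (Z x) (w x) (Z (x + 1))

theorem exists_isGuess_of_isAccRun (hZ : 𝒜.compl.IsAccRun w Z) :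
    ∃ β γ : 𝒜.Mat, 𝒜.Rejecting β.1 γ.1 ∧ IsGuess w β γ Z := by
  have step (x : M.Num) : 𝒜.ComplStep (Z x) (w x) (Z (x + 1)) := hZ.step x
  have first := step 0
  rw [show Z 0 = .init from hZ.zero, zero_add, complStep_init_iff] at first
  obtain ⟨β, γ, hrej, hZ₁⟩ := first
  exact ⟨β, γ, hrej, hZ.zero, hZ₁, fun x _ => step x⟩

theorem IsGuess.isAccRun (hZ : IsGuess w β γ Z) (hrej : 𝒜.Rejecting β.1 γ.1)
    (h : ∃ᶠ x in atTop, Z x = .one γ) : 𝒜.compl.IsAccRun w Z := by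
  refine ⟨hZ.zero, fun x => ?_, h.mono fun x hx => ⟨γ, hx.symm⟩⟩
  rcases eq_zero_or_pos x with rfl | hx
  · change 𝒜.ComplStep (Z 0) (w 0) (Z (0 + 1))
    rw [hZ.zero, zero_add, hZ.one]
    exact complStep_init_iff.2 ⟨β, γ, hrej, rfl⟩
  · exact hZ.step x hx

theorem IsGuess.pos_of_eq_one (hZ : IsGuess w β γ Z) {γ' : 𝒜.Mat} {x : M.Num} (hx : Z x = .one γ') :
    0 < x := by
  refine pos_of_ne_zero ?_
  rintro rfl
  cases hZ.zero.symm.trans hx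

variable [Finite Q]

theorem complStep_three_iff : 𝒜.ComplStep (.three β γ ζ) a s ↔
    s = .three β γ (ζ * 𝒜.letter a) ∨ s = .one γ ∧ ζ * 𝒜.letter a = β := by
  constructor
  · rintro (_ | ⟨_, _, _, _, ζ', h⟩ | ⟨_, _, _, _, h⟩)
    · exact .inl (congrArg _ (Subtype.ext h))
    · exact .inr ⟨rfl, Subtype.ext h⟩
  · rintro (rfl | ⟨rfl, rfl⟩)
    · exact .threeStep _ _ _ _ _ rfl
    · exact .threeDone _ _ _ _ rfl

theorem complStep_two_iff : 𝒜.ComplStep (.two γ ζ) a s ↔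
    s = .two γ (ζ * 𝒜.letter a) ∨ s = .one γ ∧ ζ * 𝒜.letter a = γ := by
  constructor
  · rintro (_ | _ | _ | _ | ⟨_, _, _, ζ', h⟩ | ⟨_, _, _, h⟩)
    · exact .inl (congrArg _ (Subtype.ext h))
    · exact .inr ⟨rfl, Subtype.ext h⟩
  · rintro (rfl | ⟨rfl, rfl⟩)
    · exact .twoStep _ _ _ _ rfl
    · exact .twoDone _ _ _ rfl

/-- The matrix `ξ` of a word that leads to the state `s`, when the word is factorised into a word
with matrix `β`, then words with matrix `γ`, and finally the part recorded in `s`. As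
`β * γ = β` is assumed where this is used, the number of factors `γ` does not matter. In the case
`firstNext`, the word is read from the state `.one γ`, so that its first factor has matrix `γ`. -/
inductive Reads (β γ : 𝒜.Mat) : 𝒜.ComplState → 𝒜.Mat → Prop
  | first (ξ : 𝒜.Mat) : Reads β γ (.three β γ ξ) ξ
  | done : Reads β γ (.one γ) β
  | next (ζ : 𝒜.Mat) : Reads β γ (.two γ ζ) (β * ζ)
  | firstNext (ζ : 𝒜.Mat) : β = γ → Reads β γ (.two γ ζ) ζ

theorem Reads.step (h : Reads β γ s ξ) (hβγ : β * γ = β) (hs : 𝒜.ComplStep s a s') :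
    Reads β γ s' (ξ * 𝒜.letter a) := by
  cases h with
  | first =>
    obtain rfl | ⟨rfl, h⟩ := complStep_three_iff.1 hs
    · exact .first _
    · exact h ▸ .done
  | done =>
    obtain rfl | ⟨rfl, h⟩ := complStep_one_iff.1 hs
    · exact .next _
    · rw [h, hβγ]
      exact .done
  | next ζ =>
    rw [mul_assoc]
    obtain rfl | ⟨rfl, h⟩ := complStep_two_iff.1 hs
    · exact .next _
    · rw [h, hβγ]
      exact .done
  | firstNext _ hβ =>
    obtain rfl | ⟨rfl, h⟩ := complStep_two_iff.1 hs
    · exact .firstNext _ hβ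
    · rw [h, ← hβ]
      exact .done

theorem Reads.eq_of_one {γ' : 𝒜.Mat} (h : Reads β γ (.one γ') ξ) : γ' = γ ∧ ξ = β := by
  cases h
  exact ⟨rfl, rfl⟩

theorem Reads.of_complStep_one (hs : 𝒜.ComplStep (.one γ) a s) : Reads γ γ s (𝒜.letter a) := by
  obtain rfl | ⟨rfl, h⟩ := complStep_one_iff.1 hs
  · exact .firstNext _ rfl
  · exact h ▸ .done

namespace IsGuess

variable [Coded₂ c] [Coded Z]

theorem reads_of_le (hZ : IsGuess w β γ Z) (hc : IsProd (fun x => 𝒜.letter (w x)) c)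
    {β' γ' : 𝒜.Mat} (hβγ : β' * γ' = β') {x k y : M.Num} (hxk : x ≤ k) (hk : 0 < k)
    (h : Reads β' γ' (Z k) (c x k)) (hky : k ≤ y) : Reads β' γ' (Z y) (c x y) :=
  hc.le_induction Z (Reads β' γ') hxk h
    (fun n hn ih => ih.step hβγ (hZ.step n (hk.trans_le hn))) hky

theorem reads (hZ : IsGuess w β γ Z) (hc : IsProd (fun x => 𝒜.letter (w x)) c)
    (hβγ : β * γ = β) {x : M.Num} (hx : 0 < x) : Reads β γ (Z x) (c 0 x) := by
  refine hZ.reads_of_le hc hβγ zero_le one_pos ?_ (Order.one_le_iff_pos.2 hx)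
  have := hc.self_succ 0
  rw [zero_add] at this
  rw [hZ.one, this]
  exact .first _

theorem reads_of_eq_one (hZ : IsGuess w β γ Z) (hc : IsProd (fun x => 𝒜.letter (w x)) c)
    (hγγ : γ * γ = γ) {x y : M.Num} (hx : Z x = .one γ) (hxy : x < y) :
    Reads γ γ (Z y) (c x y) := by
  have step := hZ.step x (hZ.pos_of_eq_one hx)
  rw [hx] at step
  refine hZ.reads_of_le hc hγγ le_self_add (by simp) ?_ (Order.add_one_le_of_lt hxy)
  rw [hc.self_succ]
  exact .of_complStep_one step

theorem homogeneous (hZ : IsGuess w β γ Z) (hc : IsProd (fun x => 𝒜.letter (w x)) c)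
    (hβγ : β * γ = β) (hγγ : γ * γ = γ) (h : ∃ᶠ x in atTop, Z x = .one γ) :
    Homogeneous c (fun x => Z x = .one γ) β γ where
  frequently := h
  initial _ hx := (hx ▸ hZ.reads hc hβγ (hZ.pos_of_eq_one hx)).eq_of_one.2
  between _ _ hx hy hxy := (hy ▸ hZ.reads_of_eq_one hc hγγ hx hxy).eq_of_one.2

theorem frequently_eq_one (hZ : IsGuess w β γ Z) (hc : IsProd (fun x => 𝒜.letter (w x)) c)
    (hβγ : β * γ = β) (h : ∃ᶠ x in atTop, Z x ∈ 𝒜.compl.F) : ∃ᶠ x in atTop, Z x = .one γ := by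
  refine h.mono ?_
  rintro x ⟨γ', hx⟩
  have reads := hZ.reads hc hβγ (hZ.pos_of_eq_one hx.symm)
  rw [← hx] at reads ⊢
  rw [reads.eq_of_one.1]

end IsGuess

theorem not_exists_isAccRun_of_compl [Finite A] [Coded w] [Coded Z]
    (hZ : 𝒜.compl.IsAccRun w Z) : ¬ ∃ r : M.Num → Q, Coded r ∧ 𝒜.IsAccRun w r := by
  have : Coded fun x => 𝒜.letter (w x) := .of_boundedFun (.map 𝒜.letter _)
  obtain ⟨c, _, hc⟩ := exists_isProd fun x => 𝒜.letter (w x)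
  obtain ⟨β, γ, hrej, hguess⟩ := exists_isGuess_of_isAccRun hZ
  obtain ⟨hβγ, hγγ, hrej⟩ := rejecting_iff.1 hrej
  have : Coded fun x => Z x = .one γ := .of_boundedRel inferInstance
  rw [exists_isAccRun_iff hc (hguess.homogeneous hc hβγ hγγ
    (hguess.frequently_eq_one hc hβγ hZ.frequently))]
  rintro ⟨q, hq, htop⟩
  exact (hrej q hq).ne htop

/-! ### The greedy run of the complement automaton -/

open Classical in
/-- The step of `𝒜ᶜ` that guesses `(β, γ)` and then ends each factor as soon as possible, provided
that `h` holds. -/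
noncomputable def greedyStep (β γ : 𝒜.Mat) (a : A) (h : Prop) : 𝒜.ComplState → 𝒜.ComplState
  | .init => .three β γ (𝒜.letter a)
  | .three β γ ζ => if h ∧ ζ * 𝒜.letter a = β then .one γ else .three β γ (ζ * 𝒜.letter a)
  | .one γ => if h ∧ 𝒜.letter a = γ then .one γ else .two γ (𝒜.letter a)
  | .two γ ζ => if h ∧ ζ * 𝒜.letter a = γ then .one γ else .two γ (ζ * 𝒜.letter a)

theorem complStep_greedyStep (h : Prop) (hs : s ≠ .init) :
    𝒜.ComplStep s a (greedyStep β γ a h s) := by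
  rcases s with _ | γ | ⟨γ, ζ⟩ | ⟨β, γ, ζ⟩
  · exact absurd rfl hs
  · rw [complStep_one_iff, greedyStep]
    split_ifs with h'
    exacts [.inr ⟨rfl, h'.2⟩, .inl rfl]
  · rw [complStep_two_iff, greedyStep]
    split_ifs with h'
    exacts [.inr ⟨rfl, h'.2⟩, .inl rfl]
  · rw [complStep_three_iff, greedyStep]
    split_ifs with h'
    exacts [.inr ⟨rfl, h'.2⟩, .inl rfl]

theorem greedyStep_ne_init (h : Prop) : greedyStep β γ a h s ≠ .init := by
  rcases s with _ | γ | ⟨γ, ζ⟩ | ⟨β, γ, ζ⟩ <;> rw [greedyStep]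
  · nofun
  all_goals split_ifs <;> nofun

theorem of_greedyStep_eq_one {γ' : 𝒜.Mat} {h : Prop} (hs : greedyStep β γ a h s = .one γ') : h := by
  rcases s with _ | γ | ⟨γ, ζ⟩ | ⟨β, γ, ζ⟩ <;> rw [greedyStep] at hs
  · cases hs
  all_goals
    split_ifs at hs with h'
    exact h'.1

/-- `Z` is the run of `greedyStep` along `w` that ends factors only at positions in `H`. -/
structure IsGreedyRun (w : M.Num → A) (H : M.Num → Prop) (β γ : 𝒜.Mat)
    (Z : M.Num → 𝒜.ComplState) : Prop where
  zero : Z 0 = .init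
  succ : ∀ x, Z (x + 1) = greedyStep β γ (w x) (H (x + 1)) (Z x)

theorem exists_isGreedyRun [Finite A] [Coded w] [Coded H] (β γ : 𝒜.Mat) :
    ∃ Z, Coded Z ∧ IsGreedyRun w H β γ Z := by
  let advance (t : A × Prop) := greedyStep β γ t.1 t.2
  have : Coded fun x => advance (w x, H (x + 1)) := .of_boundedFun (.map advance _)
  obtain ⟨Z, hZ, zero, succ⟩ := exists_rec (fun x => advance (w x, H (x + 1))) .init
  exact ⟨Z, hZ, zero, succ⟩

namespace IsGreedyRun

theorem one (hZ : IsGreedyRun w H β γ Z) : Z 1 = .three β γ (𝒜.letter (w 0)) := by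
  rw [← zero_add 1, hZ.succ, hZ.zero, greedyStep]

theorem isGuess (hZ : IsGreedyRun w H β γ Z) : IsGuess w β γ Z where
  zero := hZ.zero
  one := hZ.one
  step x hx := by
    obtain ⟨y, rfl⟩ := Str.Num.exists_eq_add_one hx.ne'
    rw [hZ.succ (y + 1), hZ.succ y]
    exact complStep_greedyStep _ (greedyStep_ne_init _)

variable [Coded₂ c] [Coded Z]

/-- In the states `D ζ`, the automaton waits for a factor with matrix `θ` that started at `m`. -/
theorem exists_eq_one_of_waiting (hZ : IsGreedyRun w H β γ Z)
    (hc : IsProd (fun x => 𝒜.letter (w x)) c) {D : 𝒜.Mat → 𝒜.ComplState} {θ : 𝒜.Mat}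
    (hD : ∀ a h ζ, greedyStep β γ a h (D ζ) = .one γ ∨
      ¬ (h ∧ ζ * 𝒜.letter a = θ) ∧ greedyStep β γ a h (D ζ) = D (ζ * 𝒜.letter a))
    {m y : M.Num} (base : Z (m + 1) = .one γ ∨ Z (m + 1) = D (c m (m + 1)))
    (hmy : m + 1 < y) (hy : H y) (hcy : c m y = θ) : ∃ n, m < n ∧ Z n = .one γ := by
  by_contra! never
  obtain ⟨y, rfl⟩ := Str.Num.exists_eq_add_one (zero_le.trans_lt hmy).ne'
  have waiting {x : M.Num} (hx : m + 1 ≤ x) : Z x = D (c m x) := by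
    refine hc.le_induction Z (fun s ζ => s = D ζ) le_self_add
      (base.resolve_left (never _ (lt_add_one m))) (fun x hx ih => ?_) hx
    have next := hZ.succ x
    rw [ih] at next
    have not_one := never (x + 1) (Order.lt_add_one_iff.2 (le_self_add.trans hx))
    rw [next] at not_one ⊢
    exact ((hD _ _ _).resolve_left not_one).2
  have hmy' : m + 1 ≤ y := Order.lt_add_one_iff.1 hmy
  have not_one := never (y + 1) ((lt_add_one m).trans hmy)
  rw [hZ.succ, waiting hmy'] at not_one
  refine ((hD _ _ _).resolve_left not_one).1 ⟨hy, ?_⟩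
  rw [← hc.succ m y (le_self_add.trans hmy'), hcy]

theorem exists_eq_one (hZ : IsGreedyRun w H β γ Z) (hc : IsProd (fun x => 𝒜.letter (w x)) c)
    (hH : WeaklyHomogeneous c H β γ) : ∃ n, 0 < n ∧ Z n = .one γ := by
  obtain ⟨y, hy, hy₁⟩ := (hH.frequently.and_eventually (eventually_gt_atTop (0 + 1))).exists
  refine hZ.exists_eq_one_of_waiting hc (D := .three β γ) (θ := β) (fun a h ζ => ?_) (.inr ?_)
    hy₁ hy (hH.initial y hy).2
  · rw [greedyStep]
    split_ifs with h'
    exacts [.inl rfl, .inr ⟨h', rfl⟩]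
  · rw [hc.self_succ, zero_add, hZ.one]

theorem exists_gt_eq_one (hZ : IsGreedyRun w H β γ Z) (hc : IsProd (fun x => 𝒜.letter (w x)) c)
    (hH : WeaklyHomogeneous c H β γ) {m : M.Num} (hm : Z m = .one γ) :
    ∃ n, m < n ∧ Z n = .one γ := by
  have mem : H m := by
    obtain ⟨x, rfl⟩ := Str.Num.exists_eq_add_one (hZ.isGuess.pos_of_eq_one hm).ne'
    exact of_greedyStep_eq_one ((hZ.succ x).symm.trans hm)
  obtain ⟨y, hy, hmy, hcy⟩ := (hH.frequently.and_eventually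
    ((eventually_gt_atTop (m + 1)).and (hH.eventually m mem))).exists
  refine hZ.exists_eq_one_of_waiting hc (D := .two γ) (θ := γ) (fun a h ζ => ?_) ?_ hmy hy (hcy hy)
  · rw [greedyStep]
    split_ifs with h'
    exacts [.inl rfl, .inr ⟨h', rfl⟩]
  · rw [hZ.succ, hm, greedyStep, hc.self_succ]
    split_ifs
    exacts [.inl rfl, .inr rfl]

theorem frequently_eq_one (hZ : IsGreedyRun w H β γ Z)
    (hc : IsProd (fun x => 𝒜.letter (w x)) c) (hH : WeaklyHomogeneous c H β γ) :
    ∃ᶠ x in atTop, Z x = .one γ := by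
  refine frequently_atTop'.2 fun n => ?_
  refine Str.Num.induction (P := fun n => ∃ m, n < m ∧ Z m = .one γ)
    (hZ.exists_eq_one hc hH) (fun n ih => ?_) n
  obtain ⟨m, hnm, hm⟩ := ih
  obtain ⟨k, hmk, hk⟩ := hZ.exists_gt_eq_one hc hH hm
  exact ⟨k, (Order.add_one_le_of_lt hnm).trans_lt hmk, hk⟩

end IsGreedyRun

theorem exists_isAccRun_compl [Finite A] [Coded w]
    (h : ¬ ∃ r : M.Num → Q, Coded r ∧ 𝒜.IsAccRun w r) :
    ∃ Z : M.Num → 𝒜.ComplState, Coded Z ∧ 𝒜.compl.IsAccRun w Z := by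
  have : Coded fun x => 𝒜.letter (w x) := .of_boundedFun (.map 𝒜.letter _)
  obtain ⟨c, _, hc⟩ := exists_isProd fun x => 𝒜.letter (w x)
  obtain ⟨H, β, γ, _, hH⟩ := hc.exists_weaklyHomogeneous
  obtain ⟨Z, _, hZ⟩ := exists_isGreedyRun (w := w) (H := H) β γ
  have frequently := hZ.frequently_eq_one hc hH
  have hβγ := hH.left_mul_right hc
  have hγγ := hH.right_mul_self hc
  have : Coded fun x => Z x = .one γ := .of_boundedRel inferInstance
  rw [exists_isAccRun_iff hc (hZ.isGuess.homogeneous hc hβγ hγγ frequently)] at h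
  push Not at h
  have rejecting := rejecting_iff.2 ⟨hβγ, hγγ, fun q hq => (h q hq).lt_top⟩
  exact ⟨Z, inferInstance, hZ.isGuess.isAccRun rejecting frequently⟩

end NBA

theorem mainTheorem10 {A Q : Type*} [Finite A] [Finite Q] (𝒜 : NBA A Q)
    (cA : A ↪ ℕ) (cQ : Q ↪ ℕ) (cQc : 𝒜.ComplState ↪ ℕ) :
    SOArith.Proves.{u} SOArith.RCA0 (𝒜.complCorrect cA cQ cQc) := by
  intro M hM
  have : SOArith.IsModel M := ⟨hM⟩
  intro X
  refine imp_iff_not_or.1 fun h => ?_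
  obtain ⟨w, hw⟩ := (SOArith.Fm.realize_isSeq _ _ _ _).1 h
  have := SOArith.Represents.coded cA.injective hw
  simp only [SOArith.Fm.iff, SOArith.Fm.imp, SOArith.Fm.Realize, ← imp_iff_not_or, ← iff_def,
    NBA.realize_inLang _ cA.injective cQ.injective _ _ _ hw,
    NBA.realize_inLang _ cA.injective cQc.injective _ _ _ hw]
  constructor
  · rintro ⟨Z, _, hZ⟩
    exact NBA.not_exists_isAccRun_of_compl hZ
  · exact NBA.exists_isAccRun_compl
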